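/- All monoids are commutative; ideals may be empty, and an ideal $\mathfrak p$ of a monoid $M$ is prime if $M\setminus\mathfrak p$ is a submonoid. $\mathrm{Spec}(M)$ is the set of prime ideals of $M$ with the topology having the sets $D(f)=\{\mathfrak p : f\notin\mathfrak p\}$ as a basis, and with the sheaf of monoids $\mathcal O_M$ satisfying $\mathcal O_M(D(f))=M_f$. A monoid scheme is a topological space $X$ with a sheaf of monoids $\mathcal O_X$ that is locally isomorphic to $(\mathrm{Spec}(M),\mathcal O_M)$ for monoids $M$. It is called cancellative if $M$ is cancellative for every affine open $\mathrm{Spec}(M)\subseteq X$ (separatedness of $X$ is not assumed). An element $m$ of a monoid is regular if $mx=my$ implies $x=y$. For a monoid scheme $X$ let $\mathcal R_X(U)$ be the submonoid of those $m\in\mathcal O_X(U)$ whose germs $m_x\in\mathcal O_{X,x}$, $x\in U$, are all regular, and let $\mathcal M_X$ be the sheaf associated to the presheaf $U\mapsto \mathcal O_X(U)_{\mathcal R_X(U)}$. A Cartier divisor is a global section of the quotient sheaf $\mathcal M_X^*/\mathcal O_X^*$ of the sheaves of invertible elements; it is principal if it is the image of an element of $\mathcal M_X^*(X)$. $\mathsf{CaCl}(X)$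 is the group of Cartier divisors modulo the principal ones. A line bundle is a sheaf of sets with an action of $\mathcal O_X$ that is locally isomorphic to $\mathcal O_X$, and $\mathsf{Pic}(X)$ is the group of isomorphism classes of line bundles under $\otimes_{\mathcal O_X}$. **Proposition.** Let $X$ be a monoid scheme. Sending a Cartier divisor $D$ to the line bundle $\mathcal O_X(D)\subseteq\mathcal M_X$ (equal to $f^{-1}\mathcal O_U$ over every open $U$ on which $D$ is the class of $f\in\mathcal M_X^*(U)$) defines an injective group homomorphism $\mathsf{CaCl}(X)\to\mathsf{Pic}(X)$. If $X$ is cancellative, it is an isomorphism. -/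

import Mathlib

open CategoryTheory TopologicalSpace Opposite

universe u

namespace MonoidScheme

/-! ### Spectra of commutative monoids -/

/-- A prime ideal of a commutative monoid `M`: an ideal (the empty one is allowed) whose
complement is a submonoid of `M`. -/
@[ext]
structure Spectrum (M : Type u) [CommMonoid M] where
  /-- The underlying ideal. -/
  ideal : SemigroupIdeal M
  one_notMem : (1 : M) ∉ ideal
  mem_or_mem : ∀ a b : M, a * b ∈ ideal → a ∈ ideal ∨ b ∈ ideal

namespace Spectrum

variable {M : Type u} [CommMonoid M]

/-- The submonoid `M ∖ 𝔭`. -/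
def compl (p : Spectrum M) : Submonoid M where
  carrier := {a | a ∉ p.ideal}
  one_mem' := p.one_notMem
  mul_mem' := fun {a b} ha hb hab => (p.mem_or_mem a b hab).elim ha hb

/-- `D(f)`, the set of prime ideals that do not contain `f`. -/
def basicOpen (f : M) : Set (Spectrum M) := {p | f ∉ p.ideal}

/-- The topology on `Spec M` generated by the sets `D(f)`; they form a basis because
`D(1) = Spec M` and `D(f) ∩ D(g) = D(fg)`. -/
instance : TopologicalSpace (Spectrum M) :=
  TopologicalSpace.generateFrom (Set.range basicOpen)

variable (M) in
/-- `Spec M` as a topological space. -/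
abbrev top : TopCat.{u} := TopCat.of (Spectrum M)

/-- The sections of the structure sheaf over `U`: the families `(s 𝔭)_{𝔭 ∈ U}`, `s 𝔭 ∈ M_𝔭`, which
are locally given by a fraction `a / b` of elements of `M`. -/
def sections (U : Opens (top M)) :
    Submonoid (∀ p : U, Localization (compl p.1)) where
  carrier := {s | ∀ p : U, ∃ V : Opens (top M), p.1 ∈ V ∧ ∃ hVU : V ≤ U, ∃ a b : M,
    ∀ q : V, ∃ hb : b ∈ compl q.1, s ⟨q.1, hVU q.2⟩ = Localization.mk a ⟨b, hb⟩}
  one_mem' := fun p => ⟨U, p.2, le_rfl, 1, 1, fun q => ⟨one_mem _, (Localization.mk_one).symm⟩⟩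
  mul_mem' := by
    intro s t hs ht p
    obtain ⟨V, hV, hVU, a, b, h⟩ := hs p
    obtain ⟨V', hV', hVU', a', b', h'⟩ := ht p
    refine ⟨V ⊓ V', ⟨hV, hV'⟩, inf_le_left.trans hVU, a * a', b * b', fun q => ?_⟩
    obtain ⟨hb, e⟩ := h ⟨q.1, q.2.1⟩
    obtain ⟨hb', e'⟩ := h' ⟨q.1, q.2.2⟩
    refine ⟨mul_mem hb hb', ?_⟩
    have : (s * t) ⟨q.1, hVU q.2.1⟩ = s ⟨q.1, hVU q.2.1⟩ * t ⟨q.1, hVU q.2.1⟩ := rfl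
    rw [this, e, e', Localization.mk_mul]
    rfl

/-- Restriction of sections of the structure sheaf. -/
def sectionsRes {U V : Opens (top M)} (h : V ≤ U) : sections U →* sections V where
  toFun s := ⟨fun p => s.1 ⟨p.1, h p.2⟩, fun p => by
    obtain ⟨W, hW, hWU, a, b, e⟩ := s.2 ⟨p.1, h p.2⟩
    exact ⟨W ⊓ V, ⟨hW, p.2⟩, inf_le_right, a, b, fun q => e ⟨q.1, q.2.1⟩⟩⟩
  map_one' := rfl
  map_mul' _ _ := rfl

variable (M) in
/-- The structure presheaf of `Spec M`. -/
def structurePresheaf : TopCat.Presheaf CommMonCat.{u} (top M) where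
  obj U := CommMonCat.of (sections U.unop)
  map i := CommMonCat.ofHom (sectionsRes i.unop.le)

variable (M) in
theorem structurePresheaf_isSheaf : (structurePresheaf M).IsSheaf := by
  rw [TopCat.Presheaf.isSheaf_iff_isSheafUniqueGluing]
  intro ι U sf hsf
  have key : ∀ (x : (iSup U : Opens (top M))) (i j : ι) (hi : x.1 ∈ U i) (hj : x.1 ∈ U j),
      (sf i).1 ⟨x.1, hi⟩ = (sf j).1 ⟨x.1, hj⟩ := fun x i j hi hj =>
    congrFun (congrArg Subtype.val (hsf i j)) ⟨x.1, hi, hj⟩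
  have hx : ∀ x : (iSup U : Opens (top M)), ∃ i, x.1 ∈ U i := fun x => Opens.mem_iSup.1 x.2
  choose k hk using hx
  refine ⟨⟨fun x => (sf (k x)).1 ⟨x.1, hk x⟩, fun x => ?_⟩, fun i => ?_, fun t ht => ?_⟩
  · obtain ⟨V, hV, hVU, a, b, e⟩ := (sf (k x)).2 ⟨x.1, hk x⟩
    refine ⟨V, hV, hVU.trans (le_iSup U _), a, b, fun q => ?_⟩
    obtain ⟨hb, e⟩ := e q
    exact ⟨hb, (key ⟨q.1, (hVU.trans (le_iSup U _)) q.2⟩ (k _) (k x) (hk _) (hVU q.2)).trans e⟩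
  · exact Subtype.ext (funext fun x => key ⟨x.1, le_iSup U i x.2⟩ _ _ _ x.2)
  · refine Subtype.ext (funext fun x => ?_)
    exact congrFun (congrArg Subtype.val (ht (k x))) ⟨x.1, hk x⟩

end Spectrum

/-- The affine monoid scheme `(Spec M, 𝒪_M)`. -/
def Spec (M : Type u) [CommMonoid M] : AlgebraicGeometry.SheafedSpace CommMonCat.{u} where
  carrier := Spectrum.top M
  presheaf := Spectrum.structurePresheaf M
  IsSheaf := Spectrum.structurePresheaf_isSheaf M

/-- The open subspace `U` of the monoided space `X` is isomorphic to `(Spec M, 𝒪_M)`. -/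
def IsAffineOpen (X : AlgebraicGeometry.SheafedSpace CommMonCat.{u}) (U : Opens X) (M : Type u)
    [CommMonoid M] : Prop :=
  Nonempty (X.restrict U.isOpenEmbedding ≅ Spec M)

end MonoidScheme

/-- A monoid scheme: a topological space with a sheaf of commutative monoids which is locally
isomorphic to `(Spec M, 𝒪_M)` for commutative monoids `M`. -/
structure MonoidScheme extends AlgebraicGeometry.SheafedSpace CommMonCat.{u} where
  local_affine : ∀ x : toSheafedSpace, ∃ (U : Opens toSheafedSpace) (M : Type u) (_ : CommMonoid M),
    x ∈ U ∧ MonoidScheme.IsAffineOpen toSheafedSpace U M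

namespace MonoidScheme

open Limits

/-! ### Meromorphic functions and Cartier divisors -/

/-- Directed unions of commutative monoids exist; this provides stalks and sheafification. -/
instance hasFilteredColimits_commMonCat (J : Type u) [SmallCategory J] [IsFiltered J] :
    HasColimitsOfShape J CommMonCat.{u} :=
  ⟨fun F => ⟨⟨_, CommMonCat.FilteredColimits.colimitCoconeIsColimit F⟩⟩⟩

instance hasFilteredColimits_commGrpCat (J : Type u) [SmallCategory J] [IsFiltered J] :
    HasColimitsOfShape J CommGrpCat.{u} :=
  ⟨fun F => ⟨⟨_, CommGrpCat.FilteredColimits.colimitCoconeIsColimit F⟩⟩⟩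

variable (X : MonoidScheme.{u})

/-- The sections of the structure sheaf over `U`. -/
abbrev Γ (U : Opens X.carrier) : Type u := X.presheaf.obj (op U)

/-- The restriction of sections of the structure sheaf. -/
abbrev resO {U V : Opens X.carrier} (h : V ≤ U) : X.Γ U →* X.Γ V :=
  (X.presheaf.map (homOfLE h).op).hom

/-- The stalk `𝒪_{X,x}`, the colimit of `𝒪_X(U)` over the open neighbourhoods `U` of `x`. -/
noncomputable abbrev stalk (x : X.carrier) : CommMonCat.{u} :=
  colimit ((OpenNhds.inclusion x).op ⋙ X.presheaf)

/-- The germ at `x` of a section over `U`. -/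
noncomputable abbrev germ {U : Opens X.carrier} {x : X.carrier} (hx : x ∈ U) : X.Γ U →* X.stalk x :=
  (colimit.ι ((OpenNhds.inclusion x).op ⋙ X.presheaf) (op ⟨U, hx⟩)).hom

theorem germ_resO {U V : Opens X.carrier} (h : V ≤ U) {x : X.carrier} (hx : x ∈ V) (m : X.Γ U) :
    X.germ hx (X.resO h m) = X.germ (h hx) m := by
  have := colimit.w ((OpenNhds.inclusion x).op ⋙ X.presheaf)
    
    (homOfLE (show (⟨V, hx⟩ : OpenNhds x) ≤ ⟨U, h hx⟩ from h)).op
  exact congrArg (fun f => f.hom m) this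

/-- An element `m` of a commutative monoid is regular if `m x = m y` implies `x = y`. -/
def regularElements (M : Type u) [CommMonoid M] : Submonoid M where
  carrier := {m | ∀ x y : M, m * x = m * y → x = y}
  one_mem' := by intro x y h; simpa using h
  mul_mem' := by
    intro a b ha hb x y h
    exact hb _ _ (ha _ _ (by simpa [mul_assoc] using h))

/-- `ℛ_X(U)`: the sections over `U` all of whose germs are regular. -/
noncomputable def locallyRegular (U : Opens X.carrier) : Submonoid (X.Γ U) where
  carrier := {m | ∀ (x : X.carrier) (hx : x ∈ U), X.germ hx m ∈ regularElements (X.stalk x)}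
  one_mem' := by
    intro x hx
    rw [map_one]
    exact one_mem _
  mul_mem' := by
    intro a b ha hb x hx
    rw [map_mul]
    exact mul_mem (ha x hx) (hb x hx)

theorem resO_mem_locallyRegular {U V : Opens X.carrier} (h : V ≤ U) (m : X.locallyRegular U) :
    X.resO h m.1 ∈ X.locallyRegular V := by
  intro x hx
  rw [germ_resO]
  exact m.2 x (h hx)

/-- The presheaf `U ↦ 𝒪_X(U)_{ℛ_X(U)}`. -/
noncomputable def meroPresheaf : TopCat.Presheaf CommMonCat.{u} X.carrier where
  obj U := CommMonCat.of (Localization (X.locallyRegular U.unop))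
  map i := CommMonCat.ofHom ((Localization.monoidOf _).map
    (X.resO_mem_locallyRegular i.unop.le) (Localization.monoidOf _))
  map_id U := by
    refine CommMonCat.hom_ext ((Localization.monoidOf _).epic_of_localizationMap (MonoidHom.ext fun a => ?_))
    refine ((Localization.monoidOf _).map_eq (X.resO_mem_locallyRegular le_rfl) a).trans ?_
    exact congrArg (Localization.monoidOf _) (congrArg (fun f => f.hom a) (X.presheaf.map_id U))
  map_comp {U V W} i j := by
    refine CommMonCat.hom_ext ((Localization.monoidOf _).epic_of_localizationMap (MonoidHom.ext fun a => ?_))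
    refine ((Localization.monoidOf _).map_eq
      (X.resO_mem_locallyRegular (i ≫ j).unop.le) a).trans ?_
    refine Eq.trans ?_ (congrArg ((Localization.monoidOf _).map
      (X.resO_mem_locallyRegular j.unop.le) (Localization.monoidOf _))
      ((Localization.monoidOf _).map_eq (X.resO_mem_locallyRegular i.unop.le) a)).symm
    refine Eq.trans ?_ ((Localization.monoidOf _).map_eq (X.resO_mem_locallyRegular j.unop.le) _).symm
    exact congrArg (Localization.monoidOf _)
      (congrArg (fun f => f.hom a) (X.presheaf.map_comp i j))

/-- The canonical map from `𝒪_X` to the presheaf `U ↦ 𝒪_X(U)_{ℛ_X(U)}`. -/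
noncomputable def toMeroPresheaf : X.presheaf ⟶ X.meroPresheaf where
  app U := CommMonCat.ofHom (Localization.monoidOf (X.locallyRegular U.unop)).toMonoidHom
  naturality U V i := by
    refine CommMonCat.hom_ext (MonoidHom.ext fun z => ?_)
    exact ((Localization.monoidOf (X.locallyRegular U.unop)).map_eq
      (k := Localization.monoidOf (X.locallyRegular V.unop))
      (X.resO_mem_locallyRegular i.unop.le) z).symm

/-- The sheaf `ℳ_X` of meromorphic functions on `X`. -/
noncomputable def mero : TopCat.Sheaf CommMonCat.{u} X.carrier :=
  (presheafToSheaf (Opens.grothendieckTopology X.carrier) CommMonCat.{u}).obj X.meroPresheaf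

/-- The canonical map `𝒪_X → ℳ_X`. -/
noncomputable def toMero : X.presheaf ⟶ X.mero.obj :=
  X.toMeroPresheaf ≫ toSheafify (Opens.grothendieckTopology X.carrier) X.meroPresheaf

/-- The canonical map `𝒪_X(U) → ℳ_X(U)`. -/
noncomputable abbrev toMeroApp (U : Opens X.carrier) : X.Γ U →* X.mero.obj.obj (op U) :=
  (X.toMero.app (op U)).hom

/-- The presheaf `U ↦ ℳ_X(U)ˣ / 𝒪_X(U)ˣ` of abelian groups. -/
noncomputable def divisorPresheaf : TopCat.Presheaf CommGrpCat.{u} X.carrier where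
  obj U := CommGrpCat.of
    ((X.mero.obj.obj U : Type u)ˣ ⧸ (Units.map (X.toMero.app U).hom).range)
  map {U V} i := CommGrpCat.ofHom (QuotientGroup.map _ _ (Units.map (X.mero.obj.map i).hom) (by
    rintro _ ⟨a, rfl⟩
    refine ⟨Units.map (X.presheaf.map i).hom a, Units.ext ?_⟩
    exact congrArg (fun f => f.hom a.1) (X.toMero.naturality i)))
  map_id U := by
    ext z
    exact congrArg (QuotientGroup.mk' _)
      (Units.ext (congrArg (fun f => f.hom z.1) (X.mero.obj.map_id U)))
  map_comp i j := by
    ext z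
    exact congrArg (QuotientGroup.mk' _)
      (Units.ext (congrArg (fun f => f.hom z.1) (X.mero.obj.map_comp i j)))

/-- The quotient sheaf `ℳ_X^* / 𝒪_X^*`. -/
noncomputable def divisorSheaf : TopCat.Sheaf CommGrpCat.{u} X.carrier :=
  (presheafToSheaf (Opens.grothendieckTopology X.carrier) CommGrpCat.{u}).obj X.divisorPresheaf

/-- The canonical map `ℳ_X^*(U) → (ℳ_X^* / 𝒪_X^*)(U)`. -/
noncomputable def divOn (U : Opens X.carrier) :
    (X.mero.obj.obj (op U))ˣ →* X.divisorSheaf.obj.obj (op U) :=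
  ((toSheafify (Opens.grothendieckTopology X.carrier) X.divisorPresheaf).app (op U)).hom.comp
    (QuotientGroup.mk' _)

/-- The group of Cartier divisors, the global sections of `ℳ_X^* / 𝒪_X^*`. -/
abbrev CartierDivisor : Type u := X.divisorSheaf.obj.obj (op ⊤)

/-- The restriction of a Cartier divisor to an open subset. -/
noncomputable def CartierDivisor.res (U : Opens X.carrier) :
    X.CartierDivisor →* X.divisorSheaf.obj.obj (op U) :=
  (X.divisorSheaf.obj.map (homOfLE le_top).op).hom

/-- The subgroup of principal Cartier divisors. -/
noncomputable def principalDivisors : Subgroup X.CartierDivisor := (X.divOn ⊤).range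

/-- The Cartier class group: Cartier divisors modulo principal ones. -/
abbrev CaCl : Type u := X.CartierDivisor ⧸ X.principalDivisors

/-- A monoid scheme is cancellative if `M` is cancellative for every affine open `Spec M`. -/
def IsCancellative : Prop :=
  ∀ (U : Opens X.carrier) (M : Type u) [CommMonoid M],
    IsAffineOpen X.toSheafedSpace U M → IsCancelMul M

end MonoidScheme

namespace MonoidScheme

/-! ### Line bundles and the Picard group -/

variable (X : MonoidScheme.{u})

/-- A presheaf of sets on `X` with an action of `𝒪_X`. -/
structure PreOSet where
  /-- The underlying presheaf of sets. -/
  presheaf : TopCat.Presheaf (Type u) X.carrier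
  /-- The action of `𝒪_X(U)` on the sections over `U`. -/
  act : ∀ U : Opens X.carrier, MulAction (X.Γ U) (presheaf.obj (op U))
  map_smul : ∀ {U V : Opens X.carrier} (h : V ≤ U) (a : X.Γ U) (s : presheaf.obj (op U)),
    presheaf.map (homOfLE h).op (a • s) = X.resO h a • presheaf.map (homOfLE h).op s

/-- A sheaf of sets on `X` with an action of `𝒪_X`. -/
structure OSet extends PreOSet X where
  isSheaf : presheaf.IsSheaf

variable {X}

theorem resO_self {U : Opens X.carrier} (a : X.Γ U) : X.resO le_rfl a = a :=
  congrArg (fun f => f.hom a) (X.presheaf.map_id (op U))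

theorem resO_resO {U V W : Opens X.carrier} (h : V ≤ U) (h' : W ≤ V) (a : X.Γ U) :
    X.resO h' (X.resO h a) = X.resO (h'.trans h) a :=
  (congrArg (fun f => f.hom a) (X.presheaf.map_comp (homOfLE h).op (homOfLE h').op)).symm

namespace PreOSet

/-- The sections over `U`. -/
abbrev Sec (P : PreOSet X) (U : Opens X.carrier) : Type u := P.presheaf.obj (op U)

instance (P : PreOSet X) (U : Opens X.carrier) : MulAction (X.Γ U) (P.Sec U) := P.act U

/-- The restriction of sections. -/
def res (P : PreOSet X) {U V : Opens X.carrier} (h : V ≤ U) (s : P.Sec U) : P.Sec V :=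
  P.presheaf.map (homOfLE h).op s

theorem res_self (P : PreOSet X) {U : Opens X.carrier} (s : P.Sec U) : P.res le_rfl s = s :=
  ConcreteCategory.congr_hom (P.presheaf.map_id (op U)) s

theorem res_res (P : PreOSet X) {U V W : Opens X.carrier} (h : V ≤ U) (h' : W ≤ V) (s : P.Sec U) :
    P.res h' (P.res h s) = P.res (h'.trans h) s :=
  (ConcreteCategory.congr_hom (P.presheaf.map_comp (homOfLE h).op (homOfLE h').op) s).symm

theorem res_smul (P : PreOSet X) {U V : Opens X.carrier} (h : V ≤ U) (a : X.Γ U) (s : P.Sec U) :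
    P.res h (a • s) = X.resO h a • P.res h s :=
  P.map_smul h a s

/-- The section `e` over `U` is a basis: `a ↦ a e` is an isomorphism from `𝒪_U` onto the
restriction of `P` to `U`. -/
def IsFrame (P : PreOSet X) {U : Opens X.carrier} (e : P.Sec U) : Prop :=
  ∀ (V : Opens X.carrier) (h : V ≤ U), Function.Bijective fun a : X.Γ V => a • P.res h e

theorem IsFrame.res {P : PreOSet X} {U : Opens X.carrier} {e : P.Sec U} (he : P.IsFrame e)
    {V : Opens X.carrier} (h : V ≤ U) : P.IsFrame (P.res h e) := by
  intro W hW
  simp only [P.res_res]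
  exact he W _

theorem IsFrame.inj {P : PreOSet X} {U : Opens X.carrier} {e : P.Sec U} (he : P.IsFrame e)
    {V : Opens X.carrier} (h : V ≤ U) {a b : X.Γ V} (hab : a • P.res h e = b • P.res h e) : a = b :=
  (he V h).1 hab

theorem IsFrame.surj {P : PreOSet X} {U : Opens X.carrier} {e : P.Sec U} (he : P.IsFrame e)
    {V : Opens X.carrier} (h : V ≤ U) (s : P.Sec V) : ∃ a : X.Γ V, s = a • P.res h e :=
  let ⟨a, ha⟩ := (he V h).2 s
  ⟨a, ha.symm⟩

/-- The coordinate of a section with respect to a basis. -/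
noncomputable def IsFrame.coord {P : PreOSet X} {U : Opens X.carrier} {e : P.Sec U}
    (he : P.IsFrame e) {V : Opens X.carrier} (h : V ≤ U) (s : P.Sec V) : X.Γ V :=
  (he.surj h s).choose

theorem IsFrame.coord_spec {P : PreOSet X} {U : Opens X.carrier} {e : P.Sec U}
    (he : P.IsFrame e) {V : Opens X.carrier} (h : V ≤ U) (s : P.Sec V) :
    s = he.coord h s • P.res h e :=
  (he.surj h s).choose_spec

theorem IsFrame.coord_eq {P : PreOSet X} {U : Opens X.carrier} {e : P.Sec U}
    (he : P.IsFrame e) {V : Opens X.carrier} (h : V ≤ U) {s : P.Sec V} {a : X.Γ V}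
    (hs : s = a • P.res h e) : he.coord h s = a :=
  he.inj h ((he.coord_spec h s).symm.trans hs)

theorem IsFrame.coord_res {P : PreOSet X} {U : Opens X.carrier} {e : P.Sec U}
    (he : P.IsFrame e) {V W : Opens X.carrier} (h : V ≤ U) (h' : W ≤ V) (s : P.Sec V) :
    he.coord (h'.trans h) (P.res h' s) = X.resO h' (he.coord h s) := by
  apply he.coord_eq
  conv_lhs => rw [he.coord_spec h s]
  rw [P.res_smul, P.res_res]

theorem IsFrame.coord_smul {P : PreOSet X} {U : Opens X.carrier} {e : P.Sec U}
    (he : P.IsFrame e) {V : Opens X.carrier} (h : V ≤ U) (a : X.Γ V) (s : P.Sec V) :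
    he.coord h (a • s) = a * he.coord h s := by
  apply he.coord_eq
  conv_lhs => rw [he.coord_spec h s]
  rw [smul_smul]

end PreOSet

namespace OSet

theorem sep (L : OSet X) {U : Opens X.carrier} (s t : L.Sec U)
    (h : ∀ x ∈ U, ∃ (V : Opens X.carrier) (hV : V ≤ U), x ∈ V ∧ L.res hV s = L.res hV t) :
    s = t := by
  choose V hV hx e using fun x : U => h x.1 x.2
  exact TopCat.Sheaf.eq_of_locally_eq' ⟨L.presheaf, L.isSheaf⟩ V U (fun x => homOfLE (hV x))
    (fun x hxU => Opens.mem_iSup.2 ⟨⟨x, hxU⟩, hx _⟩) s t e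

theorem glue (L : OSet X) {U : Opens X.carrier}
    (Q : ∀ V : Opens X.carrier, V ≤ U → L.Sec V → Prop)
    (hres : ∀ (V W : Opens X.carrier) (hV : V ≤ U) (hW : W ≤ V) (t : L.Sec V),
      Q V hV t → Q W (hW.trans hV) (L.res hW t))
    (huniq : ∀ (V : Opens X.carrier) (hV : V ≤ U) (t t' : L.Sec V), Q V hV t → Q V hV t' → t = t')
    (hex : ∀ x ∈ U, ∃ (V : Opens X.carrier) (hV : V ≤ U) (t : L.Sec V), x ∈ V ∧ Q V hV t) :
    ∃ t : L.Sec U, ∀ (V : Opens X.carrier) (hV : V ≤ U) (t' : L.Sec V), Q V hV t' →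
      L.res hV t = t' := by
  choose V hV t hx hQ using fun x : U => hex x.1 x.2
  obtain ⟨s, hs, -⟩ := TopCat.Sheaf.existsUnique_gluing' ⟨L.presheaf, L.isSheaf⟩ V U
    (fun x => homOfLE (hV x)) (fun x hxU => Opens.mem_iSup.2 ⟨⟨x, hxU⟩, hx _⟩) t
    (fun x y => huniq _ (inf_le_left.trans (hV x)) _ _ (hres _ _ (hV x) inf_le_left _ (hQ x))
      (hres _ _ (hV y) inf_le_right _ (hQ y)))
  refine ⟨s, fun W hW t' ht' => L.sep _ _ fun x hxW => ?_⟩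
  refine ⟨V ⟨x, hW hxW⟩ ⊓ W, inf_le_right, ⟨hx _, hxW⟩, ?_⟩
  apply huniq _ (inf_le_right.trans hW)
  · rw [L.res_res]
    have := hres _ (V ⟨x, hW hxW⟩ ⊓ W) (hV ⟨x, hW hxW⟩) inf_le_left _ (hQ _)
    have e : L.res (hV ⟨x, hW hxW⟩) s = t ⟨x, hW hxW⟩ := hs _
    rwa [← e, L.res_res] at this
  · exact hres _ _ hW inf_le_right _ ht'

variable (X) in
/-- The structure sheaf acting on itself by multiplication. -/
def one : OSet X where
  presheaf := X.presheaf ⋙ forget CommMonCat.{u}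
  act U := inferInstanceAs (MulAction (X.Γ U) (X.Γ U))
  map_smul h a s := map_mul (X.resO h) a s
  isSheaf := (TopCat.Presheaf.isSheaf_iff_isSheaf_comp' (forget CommMonCat.{u}) X.presheaf).1
    X.IsSheaf

theorem isFrame_of_local (L : OSet X) {U : Opens X.carrier} (e : L.Sec U)
    (hinj : ∀ (V : Opens X.carrier) (h : V ≤ U) (a b : X.Γ V),
      a • L.res h e = b • L.res h e → a = b)
    (hsurj : ∀ (V : Opens X.carrier) (_ : V ≤ U) (s : L.Sec V), ∀ x ∈ V,
      ∃ (W : Opens X.carrier) (hW : W ≤ V) (hWU : W ≤ U) (a : X.Γ W),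
        x ∈ W ∧ L.res hW s = a • L.res hWU e) :
    L.IsFrame e := by
  refine fun V h => ⟨fun a b hab => hinj V h a b hab, fun s => ?_⟩
  obtain ⟨t, ht⟩ := (one X).glue (U := V)
    (fun W hW a => L.res hW s = (show X.Γ W from a) • L.res (hW.trans h) e)
    (fun W W' hW hW' a ha => by
      have := congrArg (L.res hW') ha
      rwa [L.res_res, L.res_smul, L.res_res] at this)
    (fun W hW a b ha hb => hinj W _ _ _ (ha.symm.trans hb))
    (fun x hx => let ⟨W, hW, _, a, hxW, e⟩ := hsurj V h s x hx; ⟨W, hW, a, hxW, e⟩)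
  refine ⟨t, L.sep _ _ fun x hx => ?_⟩
  obtain ⟨W, hW, hWU, a, hxW, e'⟩ := hsurj V h s x hx
  refine ⟨W, hW, hxW, ?_⟩
  have := ht W hW a e'
  refine ((L.res_smul hW (show X.Γ V from t) _).trans ?_).trans e'.symm
  rw [L.res_res]
  exact congrArg (fun c : X.Γ W => c • L.res hWU e) this

theorem one_isFrame {U : Opens X.carrier} : (one X).IsFrame (U := U) (1 : X.Γ U) := by
  intro V h
  have e : (one X).res h (1 : X.Γ U) = (1 : X.Γ V) := map_one (X.resO h)
  rw [e]
  have : (fun a : X.Γ V => a • (show (one X).Sec V from (1 : X.Γ V))) = id :=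
    funext fun a => mul_one a
  rw [this]
  exact Function.bijective_id

/-- An isomorphism of sheaves of sets with an action of `𝒪_X`. -/
structure Iso (L N : OSet X) where
  /-- The bijections on sections. -/
  equiv : ∀ U : Opens X.carrier, L.Sec U ≃ N.Sec U
  equiv_res : ∀ {U V : Opens X.carrier} (h : V ≤ U) (s : L.Sec U),
    equiv V (L.res h s) = N.res h (equiv U s)
  equiv_smul : ∀ {U : Opens X.carrier} (a : X.Γ U) (s : L.Sec U),
    equiv U (a • s) = a • equiv U s

/-- The identity isomorphism. -/
def Iso.refl (L : OSet X) : Iso L L := ⟨fun _ => Equiv.refl _, fun _ _ => rfl, fun _ _ => rfl⟩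

/-- The inverse isomorphism. -/
def Iso.symm {L N : OSet X} (f : Iso L N) : Iso N L where
  equiv U := (f.equiv U).symm
  equiv_res h s := by rw [Equiv.symm_apply_eq, f.equiv_res, Equiv.apply_symm_apply]
  equiv_smul a s := by rw [Equiv.symm_apply_eq, f.equiv_smul, Equiv.apply_symm_apply]

/-- The composition of isomorphisms. -/
def Iso.trans {L N K : OSet X} (f : Iso L N) (g : Iso N K) : Iso L K where
  equiv U := (f.equiv U).trans (g.equiv U)
  equiv_res h s := by simp [f.equiv_res, g.equiv_res]
  equiv_smul a s := by simp [f.equiv_smul, g.equiv_smul]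

theorem Iso.isFrame {L N : OSet X} (f : Iso L N) {U : Opens X.carrier} {e : L.Sec U}
    (he : L.IsFrame e) : N.IsFrame (f.equiv U e) := by
  intro V h
  have : (fun a : X.Γ V => a • N.res h (f.equiv U e)) =
      f.equiv V ∘ fun a : X.Γ V => a • L.res h e := by
    funext a
    simp [f.equiv_res, f.equiv_smul]
  rw [this]
  exact (f.equiv V).bijective.comp (he V h)

/-- A matching between local bases of `L` and local bases of `N` which is compatible with changes
of bases. -/
structure FrameMatch (L N : OSet X) where
  /-- The matched pairs of bases. -/
  R : ∀ U : Opens X.carrier, L.Sec U → N.Sec U → Prop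
  left : ∀ {U e n}, R U e n → L.IsFrame e
  right : ∀ {U e n}, R U e n → N.IsFrame n
  cover : ∀ x : X.carrier, ∃ (U : Opens X.carrier) (e : L.Sec U) (n : N.Sec U), x ∈ U ∧ R U e n
  compat : ∀ {U e n U' e' n'}, R U e n → R U' e' n' →
    ∀ (W : Opens X.carrier) (h : W ≤ U) (h' : W ≤ U') (c : X.Γ W),
      L.res h' e' = c • L.res h e → N.res h' n' = c • N.res h n

namespace FrameMatch

variable {L N : OSet X}

/-- The matching with the two sides exchanged. -/
def swap (m : FrameMatch L N) : FrameMatch N L where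
  R U n e := m.R U e n
  left h := m.right h
  right h := m.left h
  cover x := let ⟨U, e, n, h⟩ := m.cover x; ⟨U, n, e, h⟩
  compat := by
    intro U n e U' n' e' hR hR' W h h' c hn
    obtain ⟨d, hd⟩ := (m.left hR).surj h (L.res h' e')
    have := m.compat hR hR' W h h' d hd
    rw [hd, (m.right hR).inj h (this.symm.trans hn)]

/-- The sections `s` and `t` have the same coordinates in all matched pairs of bases. -/
def SameCoord (m : FrameMatch L N) {U : Opens X.carrier} (s : L.Sec U) (t : N.Sec U) : Prop :=
  ∀ (V : Opens X.carrier) (e : L.Sec V) (n : N.Sec V), m.R V e n →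
    ∀ (W : Opens X.carrier) (hV : W ≤ V) (hU : W ≤ U) (c : X.Γ W),
      L.res hU s = c • L.res hV e → N.res hU t = c • N.res hV n

theorem SameCoord.res {m : FrameMatch L N} {U V : Opens X.carrier} (h : V ≤ U) {s : L.Sec U}
    {t : N.Sec U} (H : m.SameCoord s t) : m.SameCoord (L.res h s) (N.res h t) := by
  intro V' e n hR W hV hU c hs
  rw [N.res_res]
  rw [L.res_res] at hs
  exact H V' e n hR W hV _ c hs

theorem SameCoord.unique {m : FrameMatch L N} {U : Opens X.carrier} {s : L.Sec U}
    {t t' : N.Sec U} (H : m.SameCoord s t) (H' : m.SameCoord s t') : t = t' := by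
  refine N.sep _ _ fun x hx => ?_
  obtain ⟨V, e, n, hxV, hR⟩ := m.cover x
  obtain ⟨c, hc⟩ := (m.left hR).surj (inf_le_right : U ⊓ V ≤ V) (L.res inf_le_left s)
  exact ⟨U ⊓ V, inf_le_left, ⟨hx, hxV⟩,
    (H V e n hR _ inf_le_right _ c hc).trans (H' V e n hR _ inf_le_right _ c hc).symm⟩

theorem SameCoord.swap {m : FrameMatch L N} {U : Opens X.carrier} {s : L.Sec U} {t : N.Sec U}
    (H : m.SameCoord s t) : m.swap.SameCoord t s := by
  intro V n e hR W hV hU c ht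
  obtain ⟨d, hd⟩ := (m.left hR).surj hV (L.res hU s)
  have := H V e n hR W hV hU d hd
  rw [hd, (m.right hR).inj hV (this.symm.trans ht)]

theorem exists_sameCoord (m : FrameMatch L N) {U : Opens X.carrier} (s : L.Sec U) :
    ∃ t, m.SameCoord s t := by
  have hex : ∀ x ∈ U, ∃ (V : Opens X.carrier) (hV : V ≤ U) (t : N.Sec V),
      x ∈ V ∧ m.SameCoord (L.res hV s) t := by
    intro x hx
    obtain ⟨V, e, n, hxV, hR⟩ := m.cover x
    obtain ⟨c, hc⟩ := (m.left hR).surj (inf_le_right : U ⊓ V ≤ V) (L.res inf_le_left s)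
    refine ⟨U ⊓ V, inf_le_left, c • N.res inf_le_right n, ⟨hx, hxV⟩, ?_⟩
    intro V' e' n' hR' W hV hU c' hs
    obtain ⟨d, hd⟩ := (m.left hR).surj (hU.trans inf_le_right) (L.res hV e')
    rw [m.compat hR hR' W (hU.trans inf_le_right) hV d hd, N.res_smul, N.res_res, smul_smul]
    rw [hc, L.res_smul, L.res_res, hd, smul_smul] at hs
    rw [(m.left hR).inj _ hs]
  obtain ⟨t, ht⟩ := N.glue (U := U) (fun V hV t => m.SameCoord (L.res hV s) t)
    (fun V W hV hW t H => by
      have := SameCoord.res hW H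
      rwa [L.res_res] at this)
    (fun V hV t t' H H' => SameCoord.unique H H') hex
  refine ⟨t, fun V e n hR W hV hU c hs => N.sep _ _ fun x hx => ?_⟩
  obtain ⟨V', hV', t', hxV', H⟩ := hex x (hU hx)
  refine ⟨V' ⊓ W, inf_le_right, ⟨hxV', hx⟩, ?_⟩
  have h1 := ht V' hV' t' H
  have h2 := H V e n hR (V' ⊓ W) (inf_le_right.trans hV) inf_le_left (X.resO inf_le_right c) (by
    have := congrArg (L.res (inf_le_right : V' ⊓ W ≤ W)) hs
    rw [L.res_res, L.res_smul, L.res_res] at this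
    rw [L.res_res]
    exact this)
  rw [← h1, N.res_res] at h2
  rw [N.res_res, N.res_smul, N.res_res]
  exact h2

/-- Sheaves with matching local bases are isomorphic. -/
theorem nonempty_iso (m : FrameMatch L N) : Nonempty (Iso L N) := by
  choose f hf using fun U => m.exists_sameCoord (U := U)
  choose g hg using fun U => m.swap.exists_sameCoord (U := U)
  refine ⟨⟨fun U => ⟨f U, g U, fun s => ((hg U _).unique (hf U s).swap),
    fun t => (hf U _).unique (hg U t).swap⟩,
    fun {U V} h s => (hf V _).unique ((hf U s).res h), fun {U} a s => (hf U _).unique ?_⟩⟩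
  intro V e n hR W hV hU c hs
  obtain ⟨d, hd⟩ := (m.left hR).surj hV (L.res hU s)
  change N.res hU (a • f U s) = _
  rw [N.res_smul, hf U s V e n hR W hV hU d hd, smul_smul]
  rw [L.res_smul, hd, smul_smul] at hs
  rw [(m.left hR).inj hV hs]

end FrameMatch

end OSet

end MonoidScheme

namespace MonoidScheme

/-! ### Tensor products -/

/-- The tensor product `S ⊗_M T` of two sets with an action of the commutative monoid `M`: the
quotient of `S × T` by the equivalence relation generated by `(m s, t) ∼ (s, m t)`. -/
def ActTensor (M S T : Type u) [CommMonoid M] [MulAction M S] [MulAction M T] : Type u :=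
  Quot fun p q : S × T => ∃ (m : M) (s : S) (t : T), p = (m • s, t) ∧ q = (s, m • t)

namespace ActTensor

variable {M S T : Type u} [CommMonoid M] [MulAction M S] [MulAction M T]

/-- The class `s ⊗ t`. -/
def tmul (s : S) (t : T) : ActTensor M S T := Quot.mk _ (s, t)

theorem smul_tmul (m : M) (s : S) (t : T) : (tmul (m • s) t : ActTensor M S T) = tmul s (m • t) :=
  Quot.sound ⟨m, s, t, rfl, rfl⟩

theorem ind {P : ActTensor M S T → Prop} (h : ∀ s t, P (tmul s t)) (z : ActTensor M S T) : P z :=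
  Quot.ind (fun p => h p.1 p.2) z

/-- The map out of a tensor product defined by a balanced map. -/
def lift {Z : Type u} (f : S → T → Z) (hf : ∀ (m : M) s t, f (m • s) t = f s (m • t)) :
    ActTensor M S T → Z :=
  Quot.lift (fun p => f p.1 p.2) (by rintro _ _ ⟨m, s, t, rfl, rfl⟩; exact hf m s t)

/-- `M` acts by `m (s ⊗ t) = (m s) ⊗ t`. -/
instance : MulAction M (ActTensor M S T) where
  smul m := lift (fun s t => tmul (m • s) t) fun n s t => by
    rw [smul_smul, mul_comm, ← smul_smul, smul_tmul]
  one_smul z := by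
    induction z using ind with
    | h s t => exact congrArg (fun s => tmul s t) (one_smul M s)
  mul_smul m n z := by
    induction z using ind with
    | h s t => exact congrArg (fun s => tmul s t) (mul_smul m n s)

theorem smul_def (m : M) (s : S) (t : T) : m • (tmul s t : ActTensor M S T) = tmul (m • s) t := rfl

end ActTensor

namespace PreOSet

variable {X : MonoidScheme.{u}}

/-- The presheaf `U ↦ P(U) ⊗_{𝒪_X(U)} Q(U)` of sets. -/
def tensorPresheaf (P Q : PreOSet X) : TopCat.Presheaf (Type u) X.carrier where
  obj U := ActTensor (X.Γ U.unop) (P.Sec U.unop) (Q.Sec U.unop)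
  map i := TypeCat.ofHom (ActTensor.lift
    (fun s t => ActTensor.tmul (P.res i.unop.le s) (Q.res i.unop.le t))
    fun m s t => by rw [P.res_smul, Q.res_smul, ActTensor.smul_tmul])
  map_id U := by
    refine ConcreteCategory.hom_ext _ _ fun z => ?_
    induction z using ActTensor.ind with
    | h s t => exact congrArg₂ ActTensor.tmul (P.res_self s) (Q.res_self t)
  map_comp i j := by
    refine ConcreteCategory.hom_ext _ _ fun z => ?_
    induction z using ActTensor.ind with
    | h s t =>
      exact congrArg₂ ActTensor.tmul (P.res_res i.unop.le j.unop.le s).symm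
        (Q.res_res i.unop.le j.unop.le t).symm

/-- The presheaf `U ↦ P(U) ⊗_{𝒪_X(U)} Q(U)` with its action of `𝒪_X`. -/
def tensor (P Q : PreOSet X) : PreOSet X where
  presheaf := P.tensorPresheaf Q
  act U := inferInstanceAs (MulAction (X.Γ U) (ActTensor (X.Γ U) (P.Sec U) (Q.Sec U)))
  map_smul := by
    intro U V h a z
    induction z using ActTensor.ind with
    | h s t => exact congrArg (fun s => (ActTensor.tmul s (Q.res h t) :
        ActTensor (X.Γ V) (P.Sec V) (Q.Sec V))) (P.res_smul h a s)

/-- The section `s ⊗ t`. -/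
def tmul {P Q : PreOSet X} {U : Opens X.carrier} (s : P.Sec U) (t : Q.Sec U) :
    (P.tensor Q).Sec U :=
  (ActTensor.tmul s t : ActTensor (X.Γ U) (P.Sec U) (Q.Sec U))

theorem tensor_ind {P Q : PreOSet X} {U : Opens X.carrier} {p : (P.tensor Q).Sec U → Prop}
    (h : ∀ s t, p (tmul s t)) (z : (P.tensor Q).Sec U) : p z :=
  ActTensor.ind h z

theorem res_tmul {P Q : PreOSet X} {U V : Opens X.carrier} (h : V ≤ U) (s : P.Sec U)
    (t : Q.Sec U) : (P.tensor Q).res h (tmul s t) = tmul (P.res h s) (Q.res h t) := rfl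

theorem smul_tmul {P Q : PreOSet X} {U : Opens X.carrier} (a : X.Γ U) (s : P.Sec U)
    (t : Q.Sec U) : a • (tmul s t : (P.tensor Q).Sec U) = tmul (a • s) t := rfl

theorem tmul_smul {P Q : PreOSet X} {U : Opens X.carrier} (a : X.Γ U) (s : P.Sec U)
    (t : Q.Sec U) : (tmul s (a • t) : (P.tensor Q).Sec U) = a • tmul s t :=
  (ActTensor.smul_tmul a s t).symm

/-! ### Sheafification, as sheaf of families of germs -/

/-- The germ of a section. -/
noncomputable abbrev germ (P : PreOSet X) {U : Opens X.carrier} {x : X.carrier} (hx : x ∈ U)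
    (s : P.Sec U) : P.presheaf.stalk x :=
  P.presheaf.germ U x hx s

theorem germ_res (P : PreOSet X) {U V : Opens X.carrier} (h : V ≤ U) {x : X.carrier} (hx : x ∈ V)
    (s : P.Sec U) : P.germ hx (P.res h s) = P.germ (h hx) s :=
  P.presheaf.germ_res_apply (homOfLE h) x hx s

theorem germ_eq (P : PreOSet X) {U V : Opens X.carrier} {x : X.carrier} (hU : x ∈ U) (hV : x ∈ V)
    {s : P.Sec U} {t : P.Sec V} (h : P.germ hU s = P.germ hV t) :
    ∃ (W : Opens X.carrier) (hWU : W ≤ U) (hWV : W ≤ V), x ∈ W ∧ P.res hWU s = P.res hWV t :=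
  let ⟨W, hx, i, j, e⟩ := P.presheaf.germ_eq x hU hV s t h
  ⟨W, i.le, j.le, hx, e⟩

theorem exists_germ (P : PreOSet X) {U : Opens X.carrier} {x : X.carrier} (hx : x ∈ U)
    (z : P.presheaf.stalk x) :
    ∃ (W : Opens X.carrier) (_ : W ≤ U) (hxW : x ∈ W) (s : P.Sec W), P.germ hxW s = z :=
  let ⟨W, h, hxW, s, e⟩ := P.presheaf.exists_le_germ_eq z hx
  ⟨W, h, hxW, s, e⟩

/-- The action of a section of `𝒪_X` over a neighbourhood of `x` on the stalk at `x`. -/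
noncomputable def stalkSMul (P : PreOSet X) {U : Opens X.carrier} {x : X.carrier} (hx : x ∈ U)
    (a : X.Γ U) (z : P.presheaf.stalk x) : P.presheaf.stalk x :=
  P.germ (P.exists_germ hx z).choose_spec.choose_spec.choose
    (X.resO (P.exists_germ hx z).choose_spec.choose a •
      (P.exists_germ hx z).choose_spec.choose_spec.choose_spec.choose)

theorem stalkSMul_germ (P : PreOSet X) {U W : Opens X.carrier} {x : X.carrier} (hW : W ≤ U)
    (hx : x ∈ W) (a : X.Γ U) (s : P.Sec W) :
    P.stalkSMul (hW hx) a (P.germ hx s) = P.germ hx (X.resO hW a • s) := by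
  have aux : ∀ (W' : Opens X.carrier) (hW' : W' ≤ U) (hx' : x ∈ W') (s' : P.Sec W'),
      P.germ hx' s' = P.germ hx s →
      P.germ hx' (X.resO hW' a • s') = P.germ hx (X.resO hW a • s) := by
    intro W' hW' hx' s' h
    obtain ⟨V, hV, hV', hxV, e⟩ := P.germ_eq _ _ h
    rw [← P.germ_res hV hxV, ← P.germ_res hV' hxV, P.res_smul, P.res_smul, e, resO_resO,
      resO_resO]
  exact aux _ _ _ _
    (P.exists_germ (hW hx) (P.germ hx s)).choose_spec.choose_spec.choose_spec.choose_spec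

/-- The sheafification of a presheaf with an action of `𝒪_X`. -/
noncomputable def sheafify (P : PreOSet X) : OSet X where
  presheaf := P.presheaf.sheafify.obj
  act U :=
    { smul := fun a f => ⟨fun x => P.stalkSMul x.2 a (f.1 x), fun x => by
        obtain ⟨V, hx, i, s, e⟩ := f.2 x
        refine ⟨V, hx, i, X.resO i.le a • s, fun y => ?_⟩
        exact (congrArg (P.stalkSMul _ a) (e y)).trans (P.stalkSMul_germ i.le y.2 a s)⟩
      one_smul := fun f => by
        refine Subtype.ext (funext fun x => ?_)
        change P.stalkSMul x.2 1 (f.1 x) = f.1 x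
        obtain ⟨W, hW, hx, s, e⟩ := P.exists_germ x.2 (f.1 x)
        rw [← e, P.stalkSMul_germ hW hx, map_one, one_smul]
      mul_smul := fun a b f => by
        refine Subtype.ext (funext fun x => ?_)
        change P.stalkSMul x.2 (a * b) (f.1 x) = P.stalkSMul x.2 a (P.stalkSMul x.2 b (f.1 x))
        obtain ⟨W, hW, hx, s, e⟩ := P.exists_germ x.2 (f.1 x)
        rw [← e, P.stalkSMul_germ hW hx, P.stalkSMul_germ hW hx, P.stalkSMul_germ hW hx, map_mul,
          mul_smul] }
  map_smul := by
    intro U V h a f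
    refine Subtype.ext (funext fun x => ?_)
    change P.stalkSMul (h x.2) a (f.1 ⟨x.1, h x.2⟩) =
      P.stalkSMul x.2 (X.resO h a) (f.1 ⟨x.1, h x.2⟩)
    obtain ⟨W, hW, hx, s, e⟩ := P.exists_germ x.2 (f.1 ⟨x.1, h x.2⟩)
    rw [← e, P.stalkSMul_germ hW hx, P.stalkSMul_germ (hW.trans h) hx, resO_resO]
  isSheaf := P.presheaf.sheafify.property

/-- The canonical map to the sheafification. -/
noncomputable def toSheafify (P : PreOSet X) {U : Opens X.carrier} (s : P.Sec U) :
    P.sheafify.Sec U :=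
  P.presheaf.toSheafify.app (op U) s

theorem toSheafify_res (P : PreOSet X) {U V : Opens X.carrier} (h : V ≤ U) (s : P.Sec U) :
    P.sheafify.res h (P.toSheafify s) = P.toSheafify (P.res h s) :=
  (ConcreteCategory.congr_hom (P.presheaf.toSheafify.naturality (homOfLE h).op) s).symm

theorem toSheafify_smul (P : PreOSet X) {U : Opens X.carrier} (a : X.Γ U) (s : P.Sec U) :
    P.toSheafify (a • s) = a • P.toSheafify s := by
  refine Subtype.ext (funext fun x => ?_)
  refine Eq.trans ?_ (P.stalkSMul_germ le_rfl x.2 a s).symm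
  rw [resO_self]
  rfl

theorem toSheafify_eq (P : PreOSet X) {U : Opens X.carrier} {s t : P.Sec U}
    (h : P.toSheafify s = P.toSheafify t) {x : X.carrier} (hx : x ∈ U) :
    ∃ (W : Opens X.carrier) (hW : W ≤ U), x ∈ W ∧ P.res hW s = P.res hW t := by
  have : P.germ hx s = P.germ hx t := congrFun (congrArg Subtype.val h) ⟨x, hx⟩
  obtain ⟨W, hW, _, hxW, e⟩ := P.germ_eq hx hx this
  exact ⟨W, hW, hxW, e⟩

theorem exists_toSheafify (P : PreOSet X) {U : Opens X.carrier} (f : P.sheafify.Sec U)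
    {x : X.carrier} (hx : x ∈ U) :
    ∃ (W : Opens X.carrier) (hW : W ≤ U) (s : P.Sec W),
      x ∈ W ∧ P.sheafify.res hW f = P.toSheafify s := by
  obtain ⟨W, hxW, i, s, e⟩ := f.2 ⟨x, hx⟩
  exact ⟨W, i.le, s, hxW, Subtype.ext (funext fun y => e y)⟩

end PreOSet

namespace OSet

variable {X : MonoidScheme.{u}}

/-- The tensor product `L ⊗_{𝒪_X} N`: the sheaf associated to `U ↦ L(U) ⊗_{𝒪_X(U)} N(U)`. -/
noncomputable abbrev tensor (L N : OSet X) : OSet X := (L.toPreOSet.tensor N.toPreOSet).sheafify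

/-- The section `s ⊗ t`. -/
noncomputable def tmul {L N : OSet X} {U : Opens X.carrier} (s : L.Sec U) (t : N.Sec U) :
    (L.tensor N).Sec U :=
  PreOSet.toSheafify _ (PreOSet.tmul s t)

theorem res_tmul {L N : OSet X} {U V : Opens X.carrier} (h : V ≤ U) (s : L.Sec U) (t : N.Sec U) :
    (L.tensor N).res h (tmul s t) = tmul (L.res h s) (N.res h t) :=
  PreOSet.toSheafify_res _ h _

theorem smul_tmul_smul {L N : OSet X} {U : Opens X.carrier} (a b : X.Γ U) (s : L.Sec U)
    (t : N.Sec U) : tmul (a • s) (b • t) = (a * b) • (tmul s t : (L.tensor N).Sec U) := by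
  rw [tmul, PreOSet.tmul_smul, ← PreOSet.smul_tmul, PreOSet.toSheafify_smul,
    PreOSet.toSheafify_smul, smul_smul, mul_comm]
  rfl

theorem isFrame_tmul {L N : OSet X} {U : Opens X.carrier} {e : L.Sec U} {n : N.Sec U}
    (he : L.IsFrame e) (hn : N.IsFrame n) : (L.tensor N).IsFrame (tmul e n) := by
  apply isFrame_of_local
  · intro V h a b hab
    refine (one X).sep (U := V) a b fun x hx => ?_
    rw [res_tmul, tmul, ← PreOSet.toSheafify_smul, ← PreOSet.toSheafify_smul] at hab
    obtain ⟨W, hW, hxW, e'⟩ := PreOSet.toSheafify_eq _ hab hx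
    refine ⟨W, hW, hxW, ?_⟩
    rw [PreOSet.res_smul, PreOSet.res_smul, PreOSet.res_tmul, PreOSet.smul_tmul,
      PreOSet.smul_tmul, L.res_res, N.res_res] at e'
    have key := congrArg (ActTensor.lift (M := X.Γ W) (S := L.Sec W) (T := N.Sec W)
      (fun s t => he.coord (hW.trans h) s * hn.coord (hW.trans h) t)
      (fun m s t => by rw [he.coord_smul, hn.coord_smul, mul_left_comm, mul_assoc])) e'
    change he.coord (hW.trans h) (X.resO hW a • L.res _ e) * hn.coord (hW.trans h) (N.res _ n) =
      he.coord (hW.trans h) (X.resO hW b • L.res _ e) * hn.coord (hW.trans h) (N.res _ n) at key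
    rw [he.coord_eq _ rfl, he.coord_eq _ rfl, hn.coord_eq (a := 1) _ (one_smul _ _).symm, mul_one,
      mul_one] at key
    exact key
  · intro V hV f x hx
    obtain ⟨W, hW, z, hxW, e'⟩ := PreOSet.exists_toSheafify _ f hx
    induction z using PreOSet.tensor_ind with
    | h s t =>
      refine ⟨W, hW, hW.trans hV, he.coord (hW.trans hV) s * hn.coord (hW.trans hV) t, hxW, ?_⟩
      refine e'.trans ?_
      change tmul s t = _
      rw [res_tmul, ← smul_tmul_smul, ← he.coord_spec, ← hn.coord_spec]

/-- The transition function of a tensor product of bases. -/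
theorem exists_of_res_tmul {L N : OSet X} {U U' : Opens X.carrier} {e : L.Sec U} {n : N.Sec U}
    {e' : L.Sec U'} {n' : N.Sec U'} (he : L.IsFrame e) (hn : N.IsFrame n)
    {W : Opens X.carrier} (h : W ≤ U) (h' : W ≤ U') {c : X.Γ W}
    (hc : (L.tensor N).res h' (tmul e' n') = c • (L.tensor N).res h (tmul e n)) :
    ∃ a b : X.Γ W, L.res h' e' = a • L.res h e ∧ N.res h' n' = b • N.res h n ∧ c = a * b := by
  obtain ⟨a, ha⟩ := he.surj h (L.res h' e')
  obtain ⟨b, hb⟩ := hn.surj h (N.res h' n')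
  refine ⟨a, b, ha, hb, (isFrame_tmul he hn).inj h (hc.symm.trans ?_)⟩
  rw [res_tmul, res_tmul, ha, hb, smul_tmul_smul]

/-! ### Duals -/

/-- The sections over `U` of the dual `ℋom_{𝒪_X}(L, 𝒪_X)`: the morphisms from the restriction of
`L` to `U` to the restriction of `𝒪_X` to `U`. -/
@[ext]
structure DualSec (L : OSet X) (U : Opens X.carrier) : Type u where
  /-- The maps on sections. -/
  toFun : ∀ V : Opens X.carrier, V ≤ U → L.Sec V → X.Γ V
  map_res : ∀ (V W : Opens X.carrier) (hV : V ≤ U) (hW : W ≤ V) (s : L.Sec V),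
    toFun W (hW.trans hV) (L.res hW s) = X.resO hW (toFun V hV s)
  map_smul : ∀ (V : Opens X.carrier) (hV : V ≤ U) (a : X.Γ V) (s : L.Sec V),
    toFun V hV (a • s) = a * toFun V hV s

/-- Restriction of morphisms. -/
def DualSec.res {L : OSet X} {U V : Opens X.carrier} (h : V ≤ U) (f : L.DualSec U) :
    L.DualSec V where
  toFun W hW := f.toFun W (hW.trans h)
  map_res V W hV hW s := f.map_res V W _ hW s
  map_smul V hV a s := f.map_smul V _ a s

/-- The presheaf `U ↦ Hom(L|_U, 𝒪_U)`. -/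
def dualPresheaf (L : OSet X) : TopCat.Presheaf (Type u) X.carrier where
  obj U := L.DualSec U.unop
  map i := TypeCat.ofHom (DualSec.res i.unop.le)

theorem sepO {U : Opens X.carrier} (a b : X.Γ U)
    (h : ∀ x ∈ U, ∃ (V : Opens X.carrier) (hV : V ≤ U), x ∈ V ∧ X.resO hV a = X.resO hV b) :
    a = b :=
  (one X).sep (U := U) a b h

theorem dualPresheaf_isSheaf (L : OSet X) : L.dualPresheaf.IsSheaf := by
  apply TopCat.Presheaf.isSheaf_of_isSheafUniqueGluing_types
  intro ι U sf hsf
  replace hsf : ∀ (i j : ι) (W : Opens X.carrier) (hi : W ≤ U i) (hj : W ≤ U j) (s : L.Sec W),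
      (show L.DualSec (U i) from sf i).toFun W hi s =
        (show L.DualSec (U j) from sf j).toFun W hj s := fun i j W hi hj s =>
    congrArg (fun f : L.DualSec (U i ⊓ U j) => f.toFun W (le_inf hi hj) s) (hsf i j)
  have hcov : ∀ (V : Opens X.carrier) (_ : V ≤ iSup U) (x : X.carrier), x ∈ V →
      ∃ i, x ∈ V ⊓ U i := fun V hV x hx =>
    let ⟨i, hi⟩ := Opens.mem_iSup.1 (hV hx)
    ⟨i, hx, hi⟩
  have hglue : ∀ (V : Opens X.carrier) (hV : V ≤ iSup U) (s : L.Sec V), ∃ t : X.Γ V,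
      ∀ (i : ι) (W : Opens X.carrier) (hW : W ≤ V) (hi : W ≤ U i),
        X.resO hW t = (show L.DualSec (U i) from sf i).toFun W hi (L.res hW s) := by
    intro V hV s
    obtain ⟨t, ht⟩ := (one X).glue (U := V)
      (fun W hW t => ∃ (i : ι) (hi : W ≤ U i),
        (show X.Γ W from t) = (show L.DualSec (U i) from sf i).toFun W hi (L.res hW s))
      (by
        rintro W W' hW hW' t ⟨i, hi, e⟩
        refine ⟨i, hW'.trans hi, ?_⟩
        have := (show L.DualSec (U i) from sf i).map_res W W' hi hW' (L.res hW s)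
        rw [L.res_res] at this
        exact (congrArg (X.resO hW') e).trans this.symm)
      (by
        rintro W hW t t' ⟨i, hi, e⟩ ⟨j, hj, e'⟩
        exact (e.trans (hsf i j W hi hj _)).trans e'.symm)
      (fun x hx =>
        let ⟨i, hi⟩ := hcov V hV x hx
        ⟨V ⊓ U i, inf_le_left, _, hi, i, inf_le_right, rfl⟩)
    exact ⟨t, fun i W hW hi => ht W hW _ ⟨i, hi, rfl⟩⟩
  choose g hg using hglue
  refine ⟨(⟨g, ?_, ?_⟩ : L.DualSec (iSup U)), fun i => ?_, fun f hf => ?_⟩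
  · intro V W hV hW s
    refine sepO _ _ fun x hx => ?_
    obtain ⟨i, hi⟩ := hcov W (hW.trans hV) x hx
    refine ⟨W ⊓ U i, inf_le_left, hi, ?_⟩
    rw [hg W _ _ i _ inf_le_left inf_le_right, resO_resO,
      hg V _ _ i _ (inf_le_left.trans hW) inf_le_right, L.res_res]
  · intro V hV a s
    refine sepO _ _ fun x hx => ?_
    obtain ⟨i, hi⟩ := hcov V hV x hx
    refine ⟨V ⊓ U i, inf_le_left, hi, ?_⟩
    rw [hg V _ _ i _ inf_le_left inf_le_right, map_mul, hg V _ _ i _ inf_le_left inf_le_right,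
      L.res_smul, DualSec.map_smul]
  · refine DualSec.ext ?_
    funext V hV s
    have := hg V (hV.trans (le_iSup U i)) s i V le_rfl hV
    rw [resO_self, L.res_self] at this
    exact this
  · refine DualSec.ext ?_
    funext V hV s
    refine sepO _ _ fun x hx => ?_
    obtain ⟨i, hi⟩ := hcov V hV x hx
    refine ⟨V ⊓ U i, inf_le_left, hi, ?_⟩
    refine Eq.trans ?_ (hg V hV s i _ inf_le_left inf_le_right).symm
    refine ((show L.DualSec (iSup U) from f).map_res V _ hV inf_le_left s).symm.trans ?_
    exact congrArg (fun f : L.DualSec (U i) => f.toFun (V ⊓ U i) inf_le_right (L.res inf_le_left s))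
      (hf i)

/-- The dual `ℋom_{𝒪_X}(L, 𝒪_X)`. -/
def dual (L : OSet X) : OSet X where
  presheaf := L.dualPresheaf
  act U :=
    { smul := fun a f => (⟨fun V hV s => X.resO hV a * f.toFun V hV s,
        fun V W hV hW s => by rw [f.map_res V W hV hW, map_mul, resO_resO],
        fun V hV b s => by rw [f.map_smul, mul_left_comm]⟩ : L.DualSec U)
      one_smul := fun f => by
        refine DualSec.ext ?_
        funext V hV s
        change X.resO hV 1 * f.toFun V hV s = f.toFun V hV s
        rw [map_one, one_mul]
      mul_smul := fun a b f => by
        refine DualSec.ext ?_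
        funext V hV s
        change X.resO hV (a * b) * f.toFun V hV s = X.resO hV a * (X.resO hV b * f.toFun V hV s)
        rw [map_mul, mul_assoc] }
  map_smul := by
    intro U V h a f
    refine DualSec.ext ?_
    funext W hW s
    change X.resO _ a * f.toFun W _ s = X.resO hW (X.resO h a) * f.toFun W _ s
    rw [resO_resO]
  isSheaf := L.dualPresheaf_isSheaf

/-- The dual basis. -/
noncomputable def dualFrame {L : OSet X} {U : Opens X.carrier} {e : L.Sec U} (he : L.IsFrame e) :
    L.dual.Sec U :=
  (⟨fun _ hV s => he.coord hV s, fun _ _ hV hW s => he.coord_res hV hW s,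
    fun _ hV a s => he.coord_smul hV a s⟩ : L.DualSec U)

theorem smul_dualFrame_apply {L : OSet X} {U V : Opens X.carrier} {e : L.Sec U}
    (he : L.IsFrame e) (h : V ≤ U) (a : X.Γ V) (W : Opens X.carrier) (hW : W ≤ V) (s : L.Sec W) :
    (show L.DualSec V from a • L.dual.res h (dualFrame he)).toFun W hW s =
      X.resO hW a * he.coord (hW.trans h) s := rfl

theorem isFrame_dualFrame {L : OSet X} {U : Opens X.carrier} {e : L.Sec U} (he : L.IsFrame e) :
    L.dual.IsFrame (dualFrame he) := by
  have one : ∀ (V : Opens X.carrier) (h : V ≤ U), he.coord h (L.res h e) = 1 := fun V h =>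
    he.coord_eq h (one_smul _ _).symm
  refine fun V h => ⟨fun a b hab => ?_, fun f => ⟨f.toFun V le_rfl (L.res h e), ?_⟩⟩
  · have := congrArg (fun f : L.DualSec V => f.toFun V le_rfl (L.res h e)) hab
    simp only at this
    rw [smul_dualFrame_apply, smul_dualFrame_apply, one, mul_one, mul_one, resO_self,
      resO_self] at this
    exact this
  · refine DualSec.ext ?_
    funext W hW s
    refine (smul_dualFrame_apply he h _ W hW s).trans ?_
    rw [← f.map_res V W le_rfl hW, L.res_res, mul_comm, ← f.map_smul, ← he.coord_spec]

end OSet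

end MonoidScheme

namespace MonoidScheme

/-! ### The Picard group -/

/-- A line bundle: a sheaf of sets with an action of `𝒪_X` which is locally isomorphic to
`𝒪_X`. -/
structure LineBundle (X : MonoidScheme.{u}) extends OSet X where
  locally_trivial : ∀ x : X.carrier, ∃ (U : Opens X.carrier) (e : toPreOSet.Sec U),
    x ∈ U ∧ toPreOSet.IsFrame e

namespace LineBundle

variable {X : MonoidScheme.{u}}

/-- Two line bundles are identified if they are isomorphic. -/
instance setoid (X : MonoidScheme.{u}) : Setoid (LineBundle X) where
  r L N := Nonempty (OSet.Iso L.toOSet N.toOSet)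
  iseqv := ⟨fun L => ⟨OSet.Iso.refl _⟩, fun ⟨f⟩ => ⟨f.symm⟩, fun ⟨f⟩ ⟨g⟩ => ⟨f.trans g⟩⟩

variable (X) in
/-- The trivial line bundle `𝒪_X`. -/
def one : LineBundle X where
  toOSet := OSet.one X
  locally_trivial x := ⟨⊤, (1 : X.Γ ⊤), trivial, OSet.one_isFrame⟩

/-- The tensor product of line bundles. -/
noncomputable def tensor (L N : LineBundle X) : LineBundle X where
  toOSet := L.toOSet.tensor N.toOSet
  locally_trivial x := by
    obtain ⟨U, e, hx, he⟩ := L.locally_trivial x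
    obtain ⟨V, n, hx', hn⟩ := N.locally_trivial x
    exact ⟨U ⊓ V, _, ⟨hx, hx'⟩,
      OSet.isFrame_tmul (he.res inf_le_left) (hn.res inf_le_right)⟩

/-- The dual line bundle. -/
noncomputable def dual (L : LineBundle X) : LineBundle X where
  toOSet := L.toOSet.dual
  locally_trivial x := by
    obtain ⟨U, e, hx, he⟩ := L.locally_trivial x
    exact ⟨U, _, hx, OSet.isFrame_dualFrame he⟩

/-- Near each point two line bundles have bases over a common neighbourhood. -/
theorem exists_frames (L N : LineBundle X) (x : X.carrier) :
    ∃ (U : Opens X.carrier) (e : L.Sec U) (n : N.Sec U), x ∈ U ∧ L.IsFrame e ∧ N.IsFrame n := by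
  obtain ⟨U, e, hx, he⟩ := L.locally_trivial x
  obtain ⟨V, n, hx', hn⟩ := N.locally_trivial x
  exact ⟨U ⊓ V, _, _, ⟨hx, hx'⟩, he.res inf_le_left, hn.res inf_le_right⟩

theorem tensor_congr {L L' N N' : LineBundle X} (f : OSet.Iso L.toOSet L'.toOSet)
    (g : OSet.Iso N.toOSet N'.toOSet) :
    Nonempty (OSet.Iso (L.tensor N).toOSet (L'.tensor N').toOSet) :=
  OSet.FrameMatch.nonempty_iso
    { R := fun U s t => ∃ (e : L.Sec U) (n : N.Sec U), L.IsFrame e ∧ N.IsFrame n ∧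
        s = OSet.tmul e n ∧ t = OSet.tmul (f.equiv U e) (g.equiv U n)
      left := by
        rintro U _ _ ⟨e, n, he, hn, rfl, rfl⟩
        exact OSet.isFrame_tmul he hn
      right := by
        rintro U _ _ ⟨e, n, he, hn, rfl, rfl⟩
        exact OSet.isFrame_tmul (f.isFrame he) (g.isFrame hn)
      cover := fun x =>
        let ⟨U, e, n, hx, he, hn⟩ := L.exists_frames N x
        ⟨U, _, _, hx, e, n, he, hn, rfl, rfl⟩
      compat := by
        rintro U _ _ U' _ _ ⟨e, n, he, hn, rfl, rfl⟩ ⟨e', n', he', hn', rfl, rfl⟩ W h h' c hc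
        obtain ⟨a, b, ha, hb, rfl⟩ := OSet.exists_of_res_tmul he hn h h' hc
        refine (OSet.res_tmul h' _ _).trans ?_
        rw [← f.equiv_res, ← g.equiv_res, ha, hb, f.equiv_smul, g.equiv_smul, f.equiv_res,
          g.equiv_res, OSet.smul_tmul_smul, ← OSet.res_tmul]
        rfl }

theorem tensor_comm (L N : LineBundle X) :
    Nonempty (OSet.Iso (L.tensor N).toOSet (N.tensor L).toOSet) :=
  OSet.FrameMatch.nonempty_iso
    { R := fun U s t => ∃ (e : L.Sec U) (n : N.Sec U), L.IsFrame e ∧ N.IsFrame n ∧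
        s = OSet.tmul e n ∧ t = OSet.tmul n e
      left := by
        rintro U _ _ ⟨e, n, he, hn, rfl, rfl⟩
        exact OSet.isFrame_tmul he hn
      right := by
        rintro U _ _ ⟨e, n, he, hn, rfl, rfl⟩
        exact OSet.isFrame_tmul hn he
      cover := fun x =>
        let ⟨U, e, n, hx, he, hn⟩ := L.exists_frames N x
        ⟨U, _, _, hx, e, n, he, hn, rfl, rfl⟩
      compat := by
        rintro U _ _ U' _ _ ⟨e, n, he, hn, rfl, rfl⟩ ⟨e', n', he', hn', rfl, rfl⟩ W h h' c hc
        obtain ⟨a, b, ha, hb, rfl⟩ := OSet.exists_of_res_tmul he hn h h' hc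
        refine (OSet.res_tmul h' _ _).trans ?_
        rw [ha, hb, OSet.smul_tmul_smul, ← OSet.res_tmul, mul_comm]
        rfl }

theorem tensor_assoc (L N K : LineBundle X) :
    Nonempty (OSet.Iso ((L.tensor N).tensor K).toOSet (L.tensor (N.tensor K)).toOSet) :=
  OSet.FrameMatch.nonempty_iso
    { R := fun U s t => ∃ (e : L.Sec U) (n : N.Sec U) (k : K.Sec U),
        L.IsFrame e ∧ N.IsFrame n ∧ K.IsFrame k ∧
        s = OSet.tmul (L := (L.tensor N).toOSet) (OSet.tmul e n) k ∧
        t = OSet.tmul (N := (N.tensor K).toOSet) e (OSet.tmul n k)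
      left := by
        rintro U _ _ ⟨e, n, k, he, hn, hk, rfl, rfl⟩
        exact OSet.isFrame_tmul (OSet.isFrame_tmul he hn) hk
      right := by
        rintro U _ _ ⟨e, n, k, he, hn, hk, rfl, rfl⟩
        exact OSet.isFrame_tmul he (OSet.isFrame_tmul hn hk)
      cover := fun x =>
        let ⟨U, e, n, hx, he, hn⟩ := L.exists_frames N x
        let ⟨V, k, hx', hk⟩ := K.locally_trivial x
        ⟨U ⊓ V, _, _, ⟨hx, hx'⟩, _, _, _, he.res inf_le_left, hn.res inf_le_left,
          hk.res inf_le_right, rfl, rfl⟩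
      compat := by
        rintro U _ _ U' _ _ ⟨e, n, k, he, hn, hk, rfl, rfl⟩ ⟨e', n', k', he', hn', hk', rfl, rfl⟩
          W h h' c hc
        obtain ⟨d, b, hd, hb, rfl⟩ := OSet.exists_of_res_tmul (OSet.isFrame_tmul he hn) hk h h' hc
        obtain ⟨a, a', ha, ha', rfl⟩ := OSet.exists_of_res_tmul he hn h h' hd
        refine (OSet.res_tmul h' _ _).trans ?_
        refine (congrArg _ (OSet.res_tmul h' _ _)).trans ?_
        rw [ha, ha', hb, OSet.smul_tmul_smul, ← OSet.res_tmul]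
        refine (OSet.smul_tmul_smul _ _ _ _).trans ?_
        rw [mul_assoc]
        exact congrArg _ (OSet.res_tmul h _ _).symm }

theorem one_tensor (L : LineBundle X) : Nonempty (OSet.Iso ((one X).tensor L).toOSet L.toOSet) :=
  OSet.FrameMatch.nonempty_iso
    { R := fun U s t => L.IsFrame t ∧ s = OSet.tmul (L := OSet.one X) (1 : X.Γ U) t
      left := by
        rintro U _ t ⟨ht, rfl⟩
        exact OSet.isFrame_tmul OSet.one_isFrame ht
      right := fun h => h.1
      cover := fun x =>
        let ⟨U, e, hx, he⟩ := L.locally_trivial x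
        ⟨U, _, e, hx, he, rfl⟩
      compat := by
        rintro U _ t U' _ t' ⟨ht, rfl⟩ ⟨ht', rfl⟩ W h h' c hc
        obtain ⟨a, b, ha, hb, rfl⟩ := OSet.exists_of_res_tmul OSet.one_isFrame ht h h' hc
        have ha' : X.resO h' 1 = a * X.resO h 1 := ha
        rw [map_one, map_one, mul_one] at ha'
        rw [hb, ← ha', one_mul] }

theorem dual_tensor (L : LineBundle X) :
    Nonempty (OSet.Iso (L.dual.tensor L).toOSet (one X).toOSet) :=
  OSet.FrameMatch.nonempty_iso
    { R := fun U s t => t = (1 : X.Γ U) ∧ ∃ (e : L.Sec U) (he : L.IsFrame e),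
        s = OSet.tmul (OSet.dualFrame he) e
      left := by
        rintro U _ _ ⟨rfl, e, he, rfl⟩
        exact OSet.isFrame_tmul (OSet.isFrame_dualFrame he) he
      right := by
        rintro U _ _ ⟨rfl, e, he, rfl⟩
        exact OSet.one_isFrame
      cover := fun x =>
        let ⟨U, e, hx, he⟩ := L.locally_trivial x
        ⟨U, _, _, hx, rfl, e, he, rfl⟩
      compat := by
        rintro U _ _ U' _ _ ⟨rfl, e, he, rfl⟩ ⟨rfl, e', he', rfl⟩ W h h' c hc
        obtain ⟨a, b, ha, hb, rfl⟩ :=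
          OSet.exists_of_res_tmul (OSet.isFrame_dualFrame he) he h h' hc
        have h1 := congrArg (fun f : L.DualSec W => f.toFun W le_rfl (L.res h' e')) ha
        have h2 : he'.coord h' (L.res h' e') = X.resO le_rfl a * he.coord h (L.res h' e') := h1
        rw [he'.coord_eq h' (one_smul _ _).symm, he.coord_eq h hb, resO_self] at h2
        have h3 : X.resO h' 1 = (a * b) * X.resO h 1 := by
          rw [map_one, map_one, mul_one, h2]
        exact h3 }

end LineBundle

/-- The Picard group: the isomorphism classes of line bundles. -/
def Pic (X : MonoidScheme.{u}) : Type (u + 1) := Quotient (LineBundle.setoid X)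

/-- The class of a line bundle. -/
def Pic.mk {X : MonoidScheme.{u}} (L : LineBundle X) : X.Pic := Quotient.mk _ L

/-- The group structure on the Picard group, given by the tensor product. -/
noncomputable instance (X : MonoidScheme.{u}) : CommGroup X.Pic where
  mul := Quotient.map₂ LineBundle.tensor fun _ _ ⟨f⟩ _ _ ⟨g⟩ => LineBundle.tensor_congr f g
  one := Pic.mk (LineBundle.one X)
  inv := Quotient.map LineBundle.dual (by
    intro L N ⟨f⟩
    obtain ⟨a⟩ := L.dual_tensor
    obtain ⟨b⟩ := N.dual_tensor
    obtain ⟨c⟩ := LineBundle.tensor_congr (OSet.Iso.refl L.dual.toOSet) f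
    obtain ⟨d⟩ := N.tensor_comm N.dual
    obtain ⟨i⟩ := L.dual.tensor_assoc N N.dual
    obtain ⟨j⟩ := N.dual.one_tensor
    obtain ⟨k⟩ := L.dual.one_tensor
    obtain ⟨l⟩ := LineBundle.tensor_comm L.dual (LineBundle.one X)
    obtain ⟨m⟩ := LineBundle.tensor_congr (OSet.Iso.refl L.dual.toOSet) (d.trans b)
    obtain ⟨n⟩ := LineBundle.tensor_congr (c.symm.trans a) (OSet.Iso.refl N.dual.toOSet)
    exact ⟨k.symm.trans (l.symm.trans (m.symm.trans (i.symm.trans (n.trans j))))⟩)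
  mul_assoc := by
    rintro ⟨L⟩ ⟨N⟩ ⟨K⟩
    exact Quotient.sound (L.tensor_assoc N K)
  one_mul := by
    rintro ⟨L⟩
    exact Quotient.sound L.one_tensor
  mul_one := by
    rintro ⟨L⟩
    obtain ⟨f⟩ := L.tensor_comm (LineBundle.one X)
    obtain ⟨g⟩ := L.one_tensor
    exact Quotient.sound ⟨f.trans g⟩
  inv_mul_cancel := by
    rintro ⟨L⟩
    exact Quotient.sound L.dual_tensor
  mul_comm := by
    rintro ⟨L⟩ ⟨N⟩
    exact Quotient.sound (L.tensor_comm N)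

/-- `L` is isomorphic to the sheaf `𝒪_X(D)`, the subsheaf of `ℳ_X` which over every open `U` where
`D` is given by `f ∈ ℳ_X^*(U)` equals `f⁻¹ 𝒪_U`. The isomorphism is given as an embedding of `L`
into `ℳ_X`. -/
def IsSheafOfDivisor {X : MonoidScheme.{u}} (D : X.CartierDivisor) (L : LineBundle X) : Prop :=
  ∃ ι : ∀ U : Opens X.carrier, L.Sec U → X.mero.obj.obj (op U),
    (∀ U, Function.Injective (ι U)) ∧
    (∀ (U V : Opens X.carrier) (h : V ≤ U) (s : L.Sec U),
      ι V (L.res h s) = (X.mero.obj.map (homOfLE h).op).hom (ι U s)) ∧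
    (∀ (U : Opens X.carrier) (a : X.Γ U) (s : L.Sec U), ι U (a • s) = X.toMeroApp U a * ι U s) ∧
    (∀ (U : Opens X.carrier) (f : (X.mero.obj.obj (op U))ˣ),
      X.divOn U f = CartierDivisor.res X U D →
      Set.range (ι U) = {m | (f : X.mero.obj.obj (op U)) * m ∈ Set.range (X.toMeroApp U)})

end MonoidScheme

/-! The sheaf `𝒪_X(D)` consists of the meromorphic functions `m` for which `f m` lies in `𝒪_X` for
every local equation `f` of `D`. This makes sense because `𝒪_X → ℳ_X` is injective
(`toMeroApp_injective`): a section with regular germs can be cancelled over every open set. Hence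
two local equations of `D` differ by a unit of `𝒪_X`, and over an open set with equation `f` the
sheaf is free with basis `f⁻¹` (`divisorOSet.isFrame`).

Line bundles are compared through their local bases: `OSet.FrameMatch.nonempty_iso` turns a matching
of bases that respects transition functions into an isomorphism. Matching `f⁻¹ ⊗ g⁻¹` with `(f g)⁻¹`
gives multiplicativity (`divisorBundle_mul`). An isomorphism `𝒪_X ≅ 𝒪_X(D)` sends `1` to a global
basis, and such a basis is the inverse of a global equation of `D` (`exists_equation_of_isFrame`).
So the kernel is exactly the group of principal divisors, which gives injectivity on `CaCl`.

For surjectivity let `X` be cancellative. The empty ideal is the generic point `η` of an affine open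
`A`: it lies in every nonempty open subset of `A`, all sections over such subsets are regular, and
sections of `𝒪_X` and of `ℳ_X` are determined near `η` (`IsGenericIn.eq_of_resM_eq`). Overlapping
affine opens have the same generic point, so no irreducibility or separatedness of `X` is needed.
Fix a basis `ε` of `L` near each generic point. Near `η` a local basis `e` of `L` equals `c ε`, and
`c` is a fraction of two sections over `A`, that is, a unit of `ℳ_X` over all of `A`. Attaching this
unit to `e` respects changes of basis, since that may be tested near `η`; `exists_iso_divisorBundle`
then produces `D`. -/

namespace MonoidScheme

open Limits

/-! ### Sheafification as a locally bijective map -/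

section Presheaf

variable {T : TopCat.{u}} {C : Type (u + 1)} [Category.{u} C] {FC : C → C → Type*}
  {CC : C → Type u} [∀ A B, FunLike (FC A B) (CC A) (CC B)] [ConcreteCategory.{u} C FC]
  [HasWeakSheafify (Opens.grothendieckTopology T) C]
  [(Opens.grothendieckTopology T).WEqualsLocallyBijective C]

theorem locally_eq_of_toSheafify_eq (P : TopCat.Presheaf C T) {U : Opens T}
    {a b : ToType (P.obj (op U))}
    (h : (toSheafify (Opens.grothendieckTopology T) P).app (op U) a =
      (toSheafify (Opens.grothendieckTopology T) P).app (op U) b) (x : T) (hx : x ∈ U) :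
    ∃ (V : Opens T) (hV : V ≤ U), x ∈ V ∧
      P.map (homOfLE hV).op a = P.map (homOfLE hV).op b := by
  obtain ⟨V, i, hi, hxV⟩ := Presheaf.equalizerSieve_mem (Opens.grothendieckTopology T)
    (toSheafify (Opens.grothendieckTopology T) P) a b h x hx
  exact ⟨V, i.le, hxV, hi⟩

theorem locally_exists_toSheafify_eq (P : TopCat.Presheaf C T) {U : Opens T}
    (s : ToType ((sheafify (Opens.grothendieckTopology T) P).obj (op U))) (x : T) (hx : x ∈ U) :
    ∃ (V : Opens T) (hV : V ≤ U) (t : ToType (P.obj (op V))), x ∈ V ∧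
      (toSheafify (Opens.grothendieckTopology T) P).app (op V) t =
        (sheafify (Opens.grothendieckTopology T) P).map (homOfLE hV).op s := by
  obtain ⟨V, i, ⟨t, ht⟩, hxV⟩ := Presheaf.imageSieve_mem (Opens.grothendieckTopology T)
    (toSheafify (Opens.grothendieckTopology T) P) s x hx
  exact ⟨V, i.le, t, hxV, ht⟩

end Presheaf

/-! ### Restriction and separation for `ℳ_X` and `ℳ_X^* / 𝒪_X^*` -/

variable (X : MonoidScheme.{u})


/-- The sections of `ℳ_X` over `U`. -/
abbrev MeroSec (U : Opens X.carrier) : Type u := X.mero.obj.obj (op U)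

/-- The restriction of sections of `ℳ_X`. -/
noncomputable abbrev resM {U V : Opens X.carrier} (h : V ≤ U) : X.MeroSec U →* X.MeroSec V :=
  (X.mero.obj.map (homOfLE h).op).hom

/-- The sections of `ℳ_X^* / 𝒪_X^*` over `U`. -/
abbrev DivSec (U : Opens X.carrier) : Type u := X.divisorSheaf.obj.obj (op U)

/-- The restriction of sections of `ℳ_X^* / 𝒪_X^*`. -/
noncomputable abbrev resD {U V : Opens X.carrier} (h : V ≤ U) : X.DivSec U →* X.DivSec V :=
  (X.divisorSheaf.obj.map (homOfLE h).op).hom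

variable {X}

theorem resM_self {U : Opens X.carrier} (m : X.MeroSec U) : X.resM le_rfl m = m :=
  congrArg (fun f => f.hom m) (X.mero.obj.map_id (op U))

theorem resM_resM {U V W : Opens X.carrier} (h : V ≤ U) (h' : W ≤ V) (m : X.MeroSec U) :
    X.resM h' (X.resM h m) = X.resM (h'.trans h) m :=
  (congrArg (fun f => f.hom m) (X.mero.obj.map_comp (homOfLE h).op (homOfLE h').op)).symm

theorem resD_resD {U V W : Opens X.carrier} (h : V ≤ U) (h' : W ≤ V) (m : X.DivSec U) :
    X.resD h' (X.resD h m) = X.resD (h'.trans h) m :=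
  (congrArg (fun f => f.hom m) (X.divisorSheaf.obj.map_comp (homOfLE h).op (homOfLE h').op)).symm

theorem resM_toMeroApp {U V : Opens X.carrier} (h : V ≤ U) (a : X.Γ U) :
    X.resM h (X.toMeroApp U a) = X.toMeroApp V (X.resO h a) :=
  (congrArg (fun f => f.hom a) (X.toMero.naturality (homOfLE h).op)).symm

theorem sepM {U : Opens X.carrier} (a b : X.MeroSec U)
    (h : ∀ x ∈ U, ∃ (V : Opens X.carrier) (hV : V ≤ U), x ∈ V ∧ X.resM hV a = X.resM hV b) :
    a = b := by
  choose V hV hx e using fun x : U => h x.1 x.2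
  exact TopCat.Sheaf.eq_of_locally_eq' X.mero V U (fun x => homOfLE (hV x))
    (fun x hxU => Opens.mem_iSup.2 ⟨⟨x, hxU⟩, hx _⟩) a b e

theorem sepD {U : Opens X.carrier} (a b : X.DivSec U)
    (h : ∀ x ∈ U, ∃ (V : Opens X.carrier) (hV : V ≤ U), x ∈ V ∧ X.resD hV a = X.resD hV b) :
    a = b := by
  choose V hV hx e using fun x : U => h x.1 x.2
  exact TopCat.Sheaf.eq_of_locally_eq' X.divisorSheaf V U (fun x => homOfLE (hV x))
    (fun x hxU => Opens.mem_iSup.2 ⟨⟨x, hxU⟩, hx _⟩) a b e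

/-! ### Stalks and regular sections -/

theorem exists_germ_eq {x : X.carrier} (z : X.stalk x) :
    ∃ (U : Opens X.carrier) (hx : x ∈ U) (a : X.Γ U), X.germ hx a = z := by
  obtain ⟨j, a, e⟩ := Concrete.colimit_exists_rep ((OpenNhds.inclusion x).op ⋙ X.presheaf) z
  exact ⟨j.unop.1, j.unop.2, a, e⟩

theorem locally_eq_of_germ_eq {U V : Opens X.carrier} {x : X.carrier} {hx : x ∈ U} {hx' : x ∈ V}
    {a : X.Γ U} {b : X.Γ V} (h : X.germ hx a = X.germ hx' b) :
    ∃ (W : Opens X.carrier) (hU : W ≤ U) (hV : W ≤ V), x ∈ W ∧ X.resO hU a = X.resO hV b := by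
  obtain ⟨k, f, g, e⟩ := Concrete.colimit_exists_of_rep_eq
    ((OpenNhds.inclusion x).op ⋙ X.presheaf) (i := op ⟨U, hx⟩) (j := op ⟨V, hx'⟩) a b h
  exact ⟨k.unop.1, f.unop.le, g.unop.le, k.unop.2, e⟩

/-- Regularity of the germs of `r` gives equality of the germs of `a` and `b`, and sections with
equal germs agree locally. -/
theorem eq_of_locallyRegular_mul_eq {U : Opens X.carrier} {r : X.Γ U}
    (hr : r ∈ X.locallyRegular U) {a b : X.Γ U} (h : r * a = r * b) : a = b := by
  refine OSet.sepO a b fun x hx => ?_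
  have := hr x hx (X.germ hx a) (X.germ hx b) (by rw [← map_mul, h, map_mul])
  obtain ⟨W, hU, _, hxW, e⟩ := locally_eq_of_germ_eq this
  exact ⟨W, hU, hxW, e⟩

/-- Equality after sheafification is equality in the localization near each point. There it means `c
a = c b` with `c` locally regular, and `c` cancels. -/
theorem toMeroApp_injective (U : Opens X.carrier) : Function.Injective (X.toMeroApp U) := by
  intro a b h
  refine OSet.sepO a b fun x hx => ?_
  obtain ⟨V, hV, hxV, e⟩ := locally_eq_of_toSheafify_eq X.meroPresheaf
    (a := (X.toMeroPresheaf.app (op U)).hom a) (b := (X.toMeroPresheaf.app (op U)).hom b) h x hx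
  refine ⟨V, hV, hxV, ?_⟩
  have e' : Localization.monoidOf (X.locallyRegular V) (X.resO hV a) =
      Localization.monoidOf (X.locallyRegular V) (X.resO hV b) :=
    (congrArg (fun f => f.hom a) (X.toMeroPresheaf.naturality (homOfLE hV).op)).trans
      (e.trans (congrArg (fun f => f.hom b) (X.toMeroPresheaf.naturality (homOfLE hV).op)).symm)
  obtain ⟨c, hc⟩ := (Localization.monoidOf (X.locallyRegular V)).eq_iff_exists.1 e'
  exact eq_of_locallyRegular_mul_eq c.2 hc

theorem isUnit_toMeroApp {U : Opens X.carrier} {r : X.Γ U} (hr : r ∈ X.locallyRegular U) :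
    IsUnit (X.toMeroApp U r) := by
  have : IsUnit (Localization.monoidOf (X.locallyRegular U) r) :=
    (Localization.monoidOf (X.locallyRegular U)).map_units ⟨r, hr⟩
  exact this.map ((toSheafify (Opens.grothendieckTopology X.carrier) X.meroPresheaf).app (op U)).hom

/-- Locally `m` comes from the localization. The equation has no denominators; `r` is invertible in
`ℳ_X` by `isUnit_toMeroApp`. -/
theorem exists_fraction {U : Opens X.carrier} (m : X.MeroSec U) (x : X.carrier) (hx : x ∈ U) :
    ∃ (V : Opens X.carrier) (hV : V ≤ U) (a r : X.Γ V), x ∈ V ∧ r ∈ X.locallyRegular V ∧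
      X.resM hV m * X.toMeroApp V r = X.toMeroApp V a := by
  obtain ⟨V, hV, t, hxV, e⟩ := locally_exists_toSheafify_eq X.meroPresheaf m x hx
  obtain ⟨⟨a, r⟩, h⟩ := (Localization.monoidOf (X.locallyRegular V)).surj t
  refine ⟨V, hV, a, r.1, hxV, r.2, ?_⟩
  refine (congrArg (· * X.toMeroApp V r.1) e.symm).trans ?_
  exact (map_mul ((toSheafify (Opens.grothendieckTopology X.carrier)
    X.meroPresheaf).app (op V)).hom t _).symm.trans (congrArg _ h)

theorem isUnit_of_locally {U : Opens X.carrier} (m : X.MeroSec U)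
    (h : ∀ x ∈ U, ∃ (V : Opens X.carrier) (hV : V ≤ U), x ∈ V ∧ IsUnit (X.resM hV m)) :
    IsUnit m := by
  choose V hV hx e using fun x : U => h x.1 x.2
  choose n hn using fun x : U => isUnit_iff_exists_inv.1 (e x)
  obtain ⟨s, hs, -⟩ := TopCat.Sheaf.existsUnique_gluing' X.mero V U
    (fun x => homOfLE (hV x)) (fun x hxU => Opens.mem_iSup.2 ⟨⟨x, hxU⟩, hx _⟩) n
    -- The local inverses agree on overlaps because both invert the restriction of `m`.
    (fun x y => by
      change X.resM inf_le_left (n x) = X.resM inf_le_right (n y)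
      have h1 := congrArg (X.resM (inf_le_left : V x ⊓ V y ≤ V x)) (hn x)
      have h2 := congrArg (X.resM (inf_le_right : V x ⊓ V y ≤ V y)) (hn y)
      rw [map_mul, map_one, resM_resM] at h1 h2
      exact left_inv_eq_right_inv (mul_comm _ _ |>.trans h1) h2)
  refine isUnit_iff_exists_inv.2 ⟨s, sepM _ _ fun x hxU => ⟨V ⟨x, hxU⟩, hV _, hx _, ?_⟩⟩
  rw [map_mul, map_one, ← hn ⟨x, hxU⟩]
  exact congrArg _ (hs ⟨x, hxU⟩)

/-! ### Local equations of Cartier divisors -/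

theorem resD_divOn {U V : Opens X.carrier} (h : V ≤ U) (f : (X.MeroSec U)ˣ) :
    X.resD h (X.divOn U f) = X.divOn V (Units.map (X.resM h) f) :=
  (congrArg (fun g => g.hom (QuotientGroup.mk f)) ((toSheafify
    (Opens.grothendieckTopology X.carrier) X.divisorPresheaf).naturality (homOfLE h).op)).symm

theorem divOn_map_toMeroApp {U : Opens X.carrier} (a : (X.Γ U)ˣ) :
    X.divOn U (Units.map (X.toMeroApp U) a) = 1 := by
  have : (QuotientGroup.mk (Units.map (X.toMeroApp U) a) :
      (X.MeroSec U)ˣ ⧸ (Units.map (X.toMeroApp U)).range) = 1 :=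
    (QuotientGroup.eq_one_iff _).2 ⟨a, rfl⟩
  exact (congrArg ((toSheafify (Opens.grothendieckTopology X.carrier)
    X.divisorPresheaf).app (op U)).hom this).trans (map_one _)

/-- Local preimages are unique by injectivity of `𝒪_X → ℳ_X`, so they glue: belonging to `𝒪_X` is a
local condition on meromorphic functions. -/
theorem exists_toMeroApp_of_locally {U : Opens X.carrier} (m : X.MeroSec U)
    (h : ∀ x ∈ U, ∃ (V : Opens X.carrier) (hV : V ≤ U), x ∈ V ∧
      ∃ a : X.Γ V, X.toMeroApp V a = X.resM hV m) :
    ∃ a : X.Γ U, X.toMeroApp U a = m := by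
  obtain ⟨t, ht⟩ := (OSet.one X).glue (U := U)
    (fun V hV a => X.toMeroApp V a = X.resM hV m)
    (fun V W hV hW a ha => by
      refine (resM_toMeroApp hW _).symm.trans ?_
      rw [← resM_resM hV hW, ← ha])
    (fun V hV a b ha hb => toMeroApp_injective V (ha.trans hb.symm))
    (fun x hx => let ⟨V, hV, hxV, a, ha⟩ := h x hx; ⟨V, hV, a, hxV, ha⟩)
  refine ⟨t, sepM _ _ fun x hx => ?_⟩
  obtain ⟨V, hV, hxV, a, ha⟩ := h x hx
  refine ⟨V, hV, hxV, ?_⟩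
  exact (resM_toMeroApp hV t).trans ((congrArg (X.toMeroApp V) (ht V hV a ha)).trans ha)

/-- Triviality in the quotient sheaf is triviality in the quotient presheaf near each point, so `f`
locally comes from `𝒪_X`. Invertibility of `a` is left out; it would follow from the same statement
for `f⁻¹`. -/
theorem exists_of_divOn_eq_one {U : Opens X.carrier} {f : (X.MeroSec U)ˣ}
    (h : X.divOn U f = 1) : ∃ a : X.Γ U, X.toMeroApp U a = f := by
  refine exists_toMeroApp_of_locally _ fun x hx => ?_
  obtain ⟨V, hV, hxV, e⟩ := locally_eq_of_toSheafify_eq X.divisorPresheaf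
    (a := QuotientGroup.mk f) (b := 1) (h.trans (map_one _).symm) x hx
  have e' : (QuotientGroup.mk (Units.map (X.resM hV) f) :
    (X.MeroSec V)ˣ ⧸ (Units.map (X.toMeroApp V)).range) = 1 := e.trans (map_one _)
  obtain ⟨a, ha⟩ := (QuotientGroup.eq_one_iff _).1 e'
  exact ⟨V, hV, hxV, a.1, congrArg Units.val ha⟩

/-- Two equations of the same divisor differ by a section of `𝒪_X`. -/
theorem exists_of_divOn_eq {U : Opens X.carrier} {f g : (X.MeroSec U)ˣ}
    (h : X.divOn U f = X.divOn U g) : ∃ a : X.Γ U, (f : X.MeroSec U) = X.toMeroApp U a * g := by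
  obtain ⟨a, ha⟩ := exists_of_divOn_eq_one (f := f * g⁻¹) (by rw [map_mul, map_inv, h, mul_inv_cancel])
  refine ⟨a, ?_⟩
  rw [ha, Units.val_mul, Units.inv_mul_cancel_right]

theorem exists_divOn_eq {U : Opens X.carrier} (D : X.DivSec U) (x : X.carrier) (hx : x ∈ U) :
    ∃ (V : Opens X.carrier) (hV : V ≤ U) (f : (X.MeroSec V)ˣ), x ∈ V ∧
      X.divOn V f = X.resD hV D := by
  obtain ⟨V, hV, t, hxV, e⟩ := locally_exists_toSheafify_eq X.divisorPresheaf D x hx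
  obtain ⟨f, rfl⟩ := QuotientGroup.mk_surjective t
  exact ⟨V, hV, f, hxV, e⟩

end MonoidScheme

namespace MonoidScheme

variable {X : MonoidScheme.{u}}

/-! ### The line bundle of a Cartier divisor -/

/-- The sections of `𝒪_X(D)` over `U`: the meromorphic functions `m` such that `f m` is regular
for every local equation `f` of `D`. -/
def DivisorBundleSec (D : X.CartierDivisor) (U : Opens X.carrier) : Type u :=
  {m : X.MeroSec U // ∀ (V : Opens X.carrier) (h : V ≤ U) (f : (X.MeroSec V)ˣ),
    X.divOn V f = X.resD le_top D → ∃ a : X.Γ V, X.toMeroApp V a = f * X.resM h m}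

/-- Restriction of sections of `𝒪_X(D)`. -/
noncomputable def DivisorBundleSec.res {D : X.CartierDivisor} {U V : Opens X.carrier} (h : V ≤ U)
    (m : DivisorBundleSec D U) : DivisorBundleSec D V :=
  ⟨X.resM h m.1, fun W hW f hf => by
    rw [resM_resM]
    exact m.2 W _ f hf⟩

/-- The sheaf of sets underlying `𝒪_X(D)`. -/
noncomputable def divisorBundlePresheaf (D : X.CartierDivisor) :
    TopCat.Presheaf (Type u) X.carrier where
  obj U := DivisorBundleSec D U.unop
  map i := TypeCat.ofHom (DivisorBundleSec.res i.unop.le)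
  map_id _ := ConcreteCategory.hom_ext _ _ fun m => Subtype.ext (resM_self m.1)
  map_comp i j := ConcreteCategory.hom_ext _ _ fun m =>
    Subtype.ext (resM_resM i.unop.le j.unop.le m.1).symm

/-- Sections are glued inside `ℳ_X`; the glued one satisfies the defining condition because that
condition is local by `exists_toMeroApp_of_locally`. -/
theorem divisorBundlePresheaf_isSheaf (D : X.CartierDivisor) :
    (divisorBundlePresheaf D).IsSheaf := by
  apply TopCat.Presheaf.isSheaf_of_isSheafUniqueGluing_types
  intro ι U sf hsf
  obtain ⟨s, hs, huniq⟩ := X.mero.existsUnique_gluing U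
    (fun i => (show DivisorBundleSec D (U i) from sf i).1)
    (fun i j => congrArg Subtype.val (hsf i j))
  replace hs : ∀ i, X.resM (le_iSup U i) s = (show DivisorBundleSec D (U i) from sf i).1 := hs
  refine ⟨(⟨s, fun V hV f hf => ?_⟩ : DivisorBundleSec D (iSup U)),
    fun i => Subtype.ext (hs i), fun t ht => Subtype.ext (huniq _ fun i => ?_)⟩
  · refine exists_toMeroApp_of_locally _ fun x hx => ?_
    obtain ⟨i, hi⟩ := Opens.mem_iSup.1 (hV hx)
    refine ⟨V ⊓ U i, inf_le_left, ⟨hx, hi⟩, ?_⟩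
    obtain ⟨a, ha⟩ := (show DivisorBundleSec D (U i) from sf i).2 (V ⊓ U i) inf_le_right
      (Units.map (X.resM inf_le_left) f) (by rw [← resD_divOn, hf, resD_resD])
    refine ⟨a, ha.trans ?_⟩
    rw [← hs i, resM_resM, map_mul, resM_resM]
    rfl
  · exact congrArg Subtype.val (ht i)

/-- The sheaf `𝒪_X(D)` with its action of `𝒪_X`. -/
noncomputable def divisorOSet (D : X.CartierDivisor) : OSet X where
  presheaf := divisorBundlePresheaf D
  act U :=
    { smul := fun a m => (⟨X.toMeroApp U a * m.1, fun V h f hf => by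
        obtain ⟨b, hb⟩ := m.2 V h f hf
        refine ⟨X.resO h a * b, ?_⟩
        rw [map_mul, map_mul, hb, resM_toMeroApp, mul_left_comm]⟩ : DivisorBundleSec D U)
      one_smul := fun m => Subtype.ext (by
        change X.toMeroApp U 1 * m.1 = m.1
        rw [map_one, one_mul])
      mul_smul := fun a b m => Subtype.ext (by
        change X.toMeroApp U (a * b) * m.1 = X.toMeroApp U a * (X.toMeroApp U b * m.1)
        rw [map_mul, mul_assoc]) }
  map_smul h a m := Subtype.ext (by
    change X.resM h (X.toMeroApp _ a * m.1) = X.toMeroApp _ (X.resO h a) * X.resM h m.1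
    rw [map_mul, resM_toMeroApp])
  isSheaf := divisorBundlePresheaf_isSheaf D

/-- The meromorphic function underlying a section of `𝒪_X(D)`. -/
noncomputable def divisorOSet.val {D : X.CartierDivisor} {U : Opens X.carrier}
    (s : (divisorOSet D).Sec U) : X.MeroSec U :=
  Subtype.val (show DivisorBundleSec D U from s)

namespace divisorOSet

variable {D : X.CartierDivisor} {U V : Opens X.carrier}

theorem val_injective : Function.Injective (val : (divisorOSet D).Sec U → X.MeroSec U) :=
  Subtype.val_injective

theorem val_res (h : V ≤ U) (s : (divisorOSet D).Sec U) :
    val ((divisorOSet D).res h s) = X.resM h (val s) := rfl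

theorem val_smul (a : X.Γ U) (s : (divisorOSet D).Sec U) :
    val (a • s) = X.toMeroApp U a * val s := rfl

/-- A single equation over `U` decides membership: any other equation `g` over `V ≤ U` is `b f` with
`b` in `𝒪_X(V)`, so `f m ∈ 𝒪_X` forces `g m ∈ 𝒪_X`. -/
theorem range_val {f : (X.MeroSec U)ˣ} (hf : X.divOn U f = X.resD le_top D) :
    Set.range (val : (divisorOSet D).Sec U → X.MeroSec U) =
      {m | (f : X.MeroSec U) * m ∈ Set.range (X.toMeroApp U)} := by
  ext m
  constructor
  · rintro ⟨s, rfl⟩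
    obtain ⟨a, ha⟩ := (show DivisorBundleSec D U from s).2 U le_rfl f hf
    rw [resM_self] at ha
    exact ⟨a, ha⟩
  · rintro ⟨a, ha⟩
    refine ⟨(⟨m, fun V h g hg => ?_⟩ : DivisorBundleSec D U), rfl⟩
    obtain ⟨b, hb⟩ := exists_of_divOn_eq (f := g) (g := Units.map (X.resM h) f)
      (by rw [hg, ← resD_divOn, hf, resD_resD])
    refine ⟨b * X.resO h a, ?_⟩
    rw [hb, map_mul, ← resM_toMeroApp, ha, map_mul, mul_assoc]
    rfl

theorem exists_val_eq_inv {f : (X.MeroSec U)ˣ} (hf : X.divOn U f = X.resD le_top D) :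
    ∃ s : (divisorOSet D).Sec U, val s = ((f⁻¹ : (X.MeroSec U)ˣ) : X.MeroSec U) := by
  have : ((f⁻¹ : (X.MeroSec U)ˣ) : X.MeroSec U) ∈
      Set.range (val : (divisorOSet D).Sec U → X.MeroSec U) := by
    rw [range_val hf]
    exact ⟨1, by rw [map_one, Units.mul_inv]⟩
  exact this

/-- The inverse of an equation of `D` is a basis of `𝒪_X(D)`. -/
theorem isFrame {f : (X.MeroSec U)ˣ} (hf : X.divOn U f = X.resD le_top D)
    {s : (divisorOSet D).Sec U} (hs : val s = ((f⁻¹ : (X.MeroSec U)ˣ) : X.MeroSec U)) :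
    (divisorOSet D).IsFrame s := by
  have hinv : ∀ (V : Opens X.carrier) (h : V ≤ U), val ((divisorOSet D).res h s) =
      (((Units.map (X.resM h) f)⁻¹ : (X.MeroSec V)ˣ) : X.MeroSec V) := by
    intro V h
    rw [val_res, hs, ← map_inv]
    rfl
  refine fun V h => ⟨fun a b hab => ?_, fun t => ?_⟩
  · have := congrArg val hab
    simp only [val_smul, hinv] at this
    exact toMeroApp_injective V (Units.mul_left_inj _ |>.1 this)
  · have ht : val t ∈ Set.range (val : (divisorOSet D).Sec V → X.MeroSec V) := ⟨t, rfl⟩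
    rw [range_val (f := Units.map (X.resM h) f) (by rw [← resD_divOn, hf, resD_resD])] at ht
    obtain ⟨a, ha⟩ := ht
    refine ⟨a, val_injective ?_⟩
    rw [val_smul, ha, hinv, mul_comm, Units.inv_mul_cancel_left]

end divisorOSet

open divisorOSet

/-- The line bundle `𝒪_X(D)`. -/
noncomputable def divisorBundle (D : X.CartierDivisor) : LineBundle X where
  toOSet := divisorOSet D
  locally_trivial x := by
    obtain ⟨U, hU, f, hx, hf⟩ := exists_divOn_eq D x trivial
    obtain ⟨s, hs⟩ := exists_val_eq_inv hf
    exact ⟨U, s, hx, isFrame hf hs⟩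

theorem isSheafOfDivisor_divisorBundle (D : X.CartierDivisor) :
    IsSheafOfDivisor D (divisorBundle D) :=
  ⟨fun _ => val, fun _ => val_injective, fun _ _ h s => val_res h s, fun _ a s => val_smul a s,
    fun _ _ hf => range_val hf⟩

/-- `𝒪_X(D) ⊗ 𝒪_X(E) ≅ 𝒪_X(D + E)`; the group of divisors is written multiplicatively. -/
theorem divisorBundle_mul (D E : X.CartierDivisor) :
    Nonempty (OSet.Iso ((divisorBundle D).tensor (divisorBundle E)).toOSet
      (divisorBundle (D * E)).toOSet) :=
  OSet.FrameMatch.nonempty_iso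
    -- The matched bases are `f⁻¹ ⊗ g⁻¹` and `(f g)⁻¹`. If the factors change by `a` and `b`, both
    -- sides change by `a b`.
    { R := fun U s t => ∃ (e : (divisorOSet D).Sec U) (n : (divisorOSet E).Sec U)
        (f g : (X.MeroSec U)ˣ), X.divOn U f = X.resD le_top D ∧ X.divOn U g = X.resD le_top E ∧
        val e = (f⁻¹ : (X.MeroSec U)ˣ).1 ∧ val n = (g⁻¹ : (X.MeroSec U)ˣ).1 ∧
        s = OSet.tmul e n ∧ val (D := D * E) t = val e * val n
      left := by
        rintro U _ _ ⟨e, n, f, g, hf, hg, he, hn, rfl, ht⟩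
        exact OSet.isFrame_tmul (isFrame hf he) (isFrame hg hn)
      right := by
        rintro U _ t ⟨e, n, f, g, hf, hg, he, hn, rfl, ht⟩
        refine isFrame (f := f * g) (by rw [map_mul, map_mul, hf, hg]) ?_
        rw [ht, he, hn, mul_inv]
        rfl
      cover := fun x => by
        obtain ⟨U, hU, f, hx, hf⟩ := exists_divOn_eq D x trivial
        obtain ⟨V, hV, g, hx', hg⟩ := exists_divOn_eq E x trivial
        have hf' : X.divOn (U ⊓ V) (Units.map (X.resM inf_le_left) f) = X.resD le_top D := by
          rw [← resD_divOn, hf, resD_resD]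
        have hg' : X.divOn (U ⊓ V) (Units.map (X.resM inf_le_right) g) = X.resD le_top E := by
          rw [← resD_divOn, hg, resD_resD]
        obtain ⟨e, he⟩ := exists_val_eq_inv hf'
        obtain ⟨n, hn⟩ := exists_val_eq_inv hg'
        obtain ⟨t, ht⟩ := exists_val_eq_inv (D := D * E)
          (f := Units.map (X.resM inf_le_left) f * Units.map (X.resM inf_le_right) g)
          (by rw [map_mul, map_mul, hf', hg'])
        refine ⟨U ⊓ V, _, t, ⟨hx, hx'⟩, e, n, _, _, hf', hg', he, hn, rfl, ?_⟩
        rw [ht, he, hn, mul_inv]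
        rfl
      compat := by
        rintro U _ t U' _ t' ⟨e, n, f, g, hf, hg, he, hn, rfl, ht⟩
          ⟨e', n', f', g', hf', hg', he', hn', rfl, ht'⟩ W h h' c hc
        obtain ⟨a, b, ha, hb, rfl⟩ :=
          OSet.exists_of_res_tmul (isFrame hf he) (isFrame hg hn) h h' hc
        refine val_injective (D := D * E) ?_
        have h1 := congrArg (val (D := D)) ha
        have h2 := congrArg (val (D := E)) hb
        rw [val_res, val_smul, val_res] at h1 h2
        refine (val_res h' t').trans (Eq.trans ?_ (val_smul (a * b) _).symm)
        refine Eq.trans ?_ (congrArg _ (val_res h t).symm)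
        rw [ht, ht', map_mul, map_mul, map_mul, h1, h2, mul_mul_mul_comm] }

/-! ### Bases of `𝒪_X(D)` and the kernel of `D ↦ 𝒪_X(D)` -/

/-- Converse of `divisorOSet.isFrame`. Locally `s` and the inverse of an equation are two bases, so
they differ by a unit of `𝒪_X`. Thus `s` is a unit of `ℳ_X`, and the factor from `𝒪_X` vanishes in
the quotient sheaf. -/
theorem exists_equation_of_isFrame {D : X.CartierDivisor} {U : Opens X.carrier}
    {s : (divisorOSet D).Sec U} (hs : (divisorOSet D).IsFrame s) :
    ∃ f : (X.MeroSec U)ˣ, val s = (f⁻¹ : (X.MeroSec U)ˣ).1 ∧ X.divOn U f = X.resD le_top D := by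
  have key : ∀ x ∈ U, ∃ (V : Opens X.carrier) (hV : V ≤ U) (f : (X.MeroSec V)ˣ) (a : (X.Γ V)ˣ),
      x ∈ V ∧ X.divOn V f = X.resD le_top D ∧
        X.resM hV (val s) = ((Units.map (X.toMeroApp V) a * f⁻¹ : (X.MeroSec V)ˣ) : X.MeroSec V) := by
    intro x hx
    obtain ⟨V, hV, f, hxV, hf⟩ := exists_divOn_eq (X.resD (le_top : U ≤ ⊤) D) x hx
    rw [resD_resD] at hf
    obtain ⟨e, he⟩ := exists_val_eq_inv hf
    obtain ⟨a, ha⟩ := (isFrame hf he).surj le_rfl ((divisorOSet D).res hV s)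
    obtain ⟨b, hb⟩ := hs.surj hV e
    rw [PreOSet.res_self] at ha
    -- Each of the bases `s` and `e` has a coordinate in the other, and these two coordinates are
    -- mutually inverse.
    have hab : a * b = 1 := by
      refine (hs.res hV).inj le_rfl ?_
      rw [PreOSet.res_self, one_smul, mul_smul, ← hb, ← ha]
    refine ⟨V, hV, f, ⟨a, b, hab, mul_comm b a ▸ hab⟩, hxV, hf, ?_⟩
    rw [← val_res, ha, val_smul, he]
    rfl
  obtain ⟨f, hf⟩ : IsUnit (val s) := isUnit_of_locally _ fun x hx =>
    let ⟨V, hV, f, a, hxV, _, e⟩ := key x hx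
    ⟨V, hV, hxV, e ▸ Units.isUnit _⟩
  refine ⟨f⁻¹, by rw [inv_inv, hf], sepD _ _ fun x hx => ?_⟩
  obtain ⟨V, hV, g, a, hxV, hg, e⟩ := key x hx
  refine ⟨V, hV, hxV, ?_⟩
  have : Units.map (X.resM hV) f = Units.map (X.toMeroApp V) a * g⁻¹ := Units.ext (by
    rw [← e, ← hf]
    rfl)
  rw [resD_divOn, resD_resD, ← hg, map_inv, this, map_inv, map_mul, divOn_map_toMeroApp, one_mul, map_inv,
    inv_inv]

/-- An isomorphism from `𝒪_X` amounts to a global basis, the image of `1`; global bases of `𝒪_X(D)`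
are the inverses of global equations of `D`. -/
theorem mem_principalDivisors_iff (D : X.CartierDivisor) :
    D ∈ X.principalDivisors ↔
      Nonempty (OSet.Iso (LineBundle.one X).toOSet (divisorBundle D).toOSet) := by
  have htop : X.resD (le_top : (⊤ : Opens X.carrier) ≤ ⊤) D = D :=
    congrArg (fun f => f.hom D) (X.divisorSheaf.obj.map_id (op ⊤))
  constructor
  · rintro ⟨f, hf⟩
    obtain ⟨s, hs⟩ := exists_val_eq_inv (D := D) (f := f) (hf.trans htop.symm)
    have hs' : (divisorOSet D).IsFrame s := isFrame (hf.trans htop.symm) hs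
    refine ⟨⟨fun U => Equiv.ofBijective _ (hs' U le_top), fun {U V} h a => ?_,
      fun {U} a b => mul_smul a b _⟩⟩
    exact (congrArg (fun t => X.resO h a • t) ((divisorOSet D).res_res le_top h s).symm).trans
      ((divisorOSet D).res_smul h a _).symm
  · rintro ⟨i⟩
    obtain ⟨f, -, hf⟩ := exists_equation_of_isFrame (D := D) (i.isFrame (OSet.one_isFrame (U := ⊤)))
    exact ⟨f, hf.trans htop⟩

/-- The class of `𝒪_X(D)` as a homomorphism. -/
noncomputable def divisorClassHom (X : MonoidScheme.{u}) : X.CartierDivisor →* X.Pic :=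
  MonoidHom.mk' (fun D => Pic.mk (divisorBundle D)) fun D E =>
    (Quotient.sound (divisorBundle_mul D E)).symm

theorem ker_divisorClassHom (X : MonoidScheme.{u}) :
    (divisorClassHom X).ker = X.principalDivisors := by
  ext D
  rw [mem_principalDivisors_iff, MonoidHom.mem_ker]
  exact ⟨fun h => Quotient.exact h.symm, fun h => (Quotient.sound h).symm⟩

end MonoidScheme

namespace MonoidScheme

/-! ### Spectra of cancellative monoids -/

namespace Spectrum

variable {M : Type u} [CommMonoid M]

variable (M) in
/-- The generic point of `Spec M`, the empty ideal. -/
def generic : Spectrum M where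
  ideal := ⊥
  one_notMem := id
  mem_or_mem _ _ h := False.elim h

theorem notMem_generic (f : M) : f ∉ (generic M).ideal := id

/-- The empty ideal lies in every `D(f)`, and induction on the generation of the topology carries
this to all nonempty open sets. -/
theorem generic_mem {V : Set (Spectrum M)} (hV : IsOpen V) {p : Spectrum M} (hp : p ∈ V) :
    generic M ∈ V := by
  induction hV with
  | basic s hs =>
    obtain ⟨f, rfl⟩ := hs
    exact notMem_generic f
  | univ => trivial
  | inter s t _ _ hs ht => exact ⟨hs hp.1, ht hp.2⟩
  | sUnion S _ ih =>
    obtain ⟨s, hs, hps⟩ := hp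
    exact ⟨s, hs, ih s hs hps⟩

theorem eq_generic {p : Spectrum M}
    (h : ∀ V : Set (Spectrum M), IsOpen V → generic M ∈ V → p ∈ V) : p = generic M := by
  refine Spectrum.ext (SetLike.ext fun f => iff_of_false ?_ (notMem_generic f))
  exact h (basicOpen f) (isOpen_generateFrom_of_mem ⟨f, rfl⟩) (notMem_generic f)

theorem mk_eq_mk_iff [IsCancelMul M] {S : Submonoid M} {a c : M} {b d : S} :
    Localization.mk a b = Localization.mk c d ↔ (d : M) * a = b * c := by
  rw [Localization.mk_eq_mk_iff, Localization.r_iff_exists]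
  exact ⟨fun ⟨e, h⟩ => mul_left_cancel h, fun h => ⟨1, by rw [h]⟩⟩

theorem localization_mul_left_cancel [IsCancelMul M] {S : Submonoid M} {x y z : Localization S}
    (h : x * y = x * z) : y = z := by
  induction x using Localization.induction_on with | _ x =>
  induction y using Localization.induction_on with | _ y =>
  induction z using Localization.induction_on with | _ z =>
  rw [Localization.mk_mul, Localization.mk_mul, mk_eq_mk_iff] at h
  rw [mk_eq_mk_iff]
  refine mul_left_cancel (a := (x.2 : M) * x.1) ?_
  push_cast at h
  rw [mul_mul_mul_comm, h, mul_mul_mul_comm]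

theorem sections_mul_left_cancel [IsCancelMul M] {U : Opens (top M)} {a b c : sections U}
    (h : a * b = a * c) : b = c :=
  Subtype.ext (funext fun p =>
    localization_mul_left_cancel (congrFun (congrArg Subtype.val h) p))

/-- The fractions that represent `s` and `t` near `p` also represent them at the generic point. By
`mk_eq_mk_iff` their equality is one equation in `M` that does not involve the prime, so it passes
from the generic point to `p`. -/
theorem sections_eq_of_generic [IsCancelMul M] {U : Opens (top M)} {s t : sections U}
    (hU : generic M ∈ U) (h : s.1 ⟨generic M, hU⟩ = t.1 ⟨generic M, hU⟩) : s = t := by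
  refine Subtype.ext (funext fun p => ?_)
  obtain ⟨V, hpV, hVU, a, b, e⟩ := s.2 p
  obtain ⟨V', hpV', hVU', a', b', e'⟩ := t.2 p
  obtain ⟨hb, h1⟩ := e ⟨generic M, generic_mem V.2 hpV⟩
  obtain ⟨hb', h1'⟩ := e' ⟨generic M, generic_mem V'.2 hpV'⟩
  obtain ⟨hc, h2⟩ := e ⟨p.1, hpV⟩
  obtain ⟨hc', h2'⟩ := e' ⟨p.1, hpV'⟩
  have key := h1.symm.trans (h.trans h1')
  rw [mk_eq_mk_iff] at key
  refine h2.trans (Eq.trans ?_ h2'.symm)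
  rw [mk_eq_mk_iff]
  exact key

/-- A global section of the structure sheaf of `Spec M`. -/
def globalSection (a : M) : sections (⊤ : Opens (top M)) :=
  ⟨fun _ => Localization.mk a 1, fun _ => ⟨⊤, trivial, le_rfl, a, 1, fun _ => ⟨one_mem _, rfl⟩⟩⟩

theorem exists_globalSection_fraction {U : Opens (top M)} (s : sections U) (p : Spectrum M)
    (hp : p ∈ U) : ∃ (V : Opens (top M)) (hV : V ≤ U) (a b : M), p ∈ V ∧
      sectionsRes le_top (globalSection b) * sectionsRes hV s =
        sectionsRes le_top (globalSection a) := by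
  obtain ⟨V, hpV, hVU, a, b, e⟩ := s.2 ⟨p, hp⟩
  refine ⟨V, hVU, a, b, hpV, Subtype.ext (funext fun q => ?_)⟩
  obtain ⟨hb, e⟩ := e q
  change Localization.mk b 1 * s.1 ⟨q.1, hVU q.2⟩ = Localization.mk a 1
  rw [e, Localization.mk_mul, Localization.mk_eq_mk_iff, Localization.r_iff_exists]
  exact ⟨1, by simp⟩

end Spectrum

/-! ### Generic points of affine open sets -/

variable {X : MonoidScheme.{u}}

/-- The point `η` is the generic point of the open set `A`, over which `X` is integral. -/
structure IsGenericIn (η : X.carrier) (A : Opens X.carrier) : Prop where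
  mem : ∀ {V : Opens X.carrier}, V ≤ A → ∀ x ∈ V, η ∈ V
  -- This makes generic points of overlapping opens coincide.
  eq_of_mem : ∀ y ∈ A, (∀ V : Opens X.carrier, V ≤ A → η ∈ V → y ∈ V) → y = η
  eq_of_res_eq : ∀ {V W : Opens X.carrier} (_ : V ≤ A) (h : W ≤ V) {a b : X.Γ V}, η ∈ W →
    X.resO h a = X.resO h b → a = b
  mul_left_cancel : ∀ {V : Opens X.carrier} (_ : V ≤ A) {a b c : X.Γ V}, a * b = a * c → b = c
  -- The fraction describes `c` only near `η`, but `a` and `b` live on all of `A`; this is what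
  -- extends `c` to a meromorphic function on `A`.
  exists_fraction : ∀ {V : Opens X.carrier} (h : V ≤ A) (c : X.Γ V), η ∈ V →
    ∃ (W : Opens X.carrier) (hW : W ≤ V) (a b : X.Γ A), η ∈ W ∧
      X.resO (hW.trans h) b * X.resO hW c = X.resO (hW.trans h) a

open AlgebraicGeometry in
-- An open immersion is a homeomorphism onto `A` and is bijective on sections over open subsets of
-- `A`, so every property can be checked on `Spec M`.
theorem isGenericIn_of_isOpenImmersion {A : Opens X.carrier} {M : Type u} [CommMonoid M]
    [IsCancelMul M] (j : (Spec M).toPresheafedSpace ⟶ X.toPresheafedSpace)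
    [hj : PresheafedSpace.IsOpenImmersion j] (hA : Set.range j.base = A) :
    IsGenericIn (j.base (Spectrum.generic M)) A := by
  have hψ : ∀ {V : Opens X.carrier}, V ≤ A → Function.Bijective (j.c.app (op V)).hom := by
    intro V hV
    -- Sections are known to correspond only over images of open sets; `V ≤ A` makes `V` the image
    -- of its preimage.
    have hV' : V = hj.base_open.functor.obj ((Opens.map j.base).obj V) := by
      refine Opens.ext (Set.image_preimage_eq_of_subset ?_).symm
      rw [hA]
      exact hV
    have := PresheafedSpace.IsOpenImmersion.c_iso' j _ hV'
    exact ConcreteCategory.bijective_of_isIso (j.c.app (op V))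
  have hnat : ∀ {V W : Opens X.carrier} (h : W ≤ V) (a : X.Γ V),
      (j.c.app (op W)).hom (X.resO h a) =
        Spectrum.sectionsRes (fun _ hp => h hp) ((j.c.app (op V)).hom a) := fun h a =>
    congrArg (fun f => f.hom a) (j.c.naturality (homOfLE h).op)
  refine ⟨fun {V} hV x hx => ?_, fun y hy h => ?_, fun {V W} hV h {a b} hη e => ?_,
    fun {V} hV {a b c} e => ?_, fun {V} hV c hη => ?_⟩
  · obtain ⟨p, rfl⟩ : x ∈ Set.range j.base := hA ▸ hV hx
    exact Spectrum.generic_mem ((Opens.map j.base).obj V).2 hx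
  · obtain ⟨p, rfl⟩ : y ∈ Set.range j.base := hA ▸ hy
    refine congrArg j.base (Spectrum.eq_generic fun V hV hη => ?_)
    obtain ⟨q, hq, e⟩ := h (hj.base_open.functor.obj ⟨V, hV⟩)
      ((Set.image_subset_range _ _).trans hA.le) ⟨_, hη, rfl⟩
    exact hj.base_open.injective e ▸ hq
  · refine (hψ hV).1 (Spectrum.sections_eq_of_generic (h hη) ?_)
    have := (hnat h a).symm.trans ((congrArg _ e).trans (hnat h b))
    exact congrFun (congrArg Subtype.val this) ⟨Spectrum.generic M, hη⟩
  · refine (hψ hV).1 (Spectrum.sections_mul_left_cancel (a := (j.c.app (op V)).hom a) ?_)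
    exact (map_mul _ a b).symm.trans ((congrArg _ e).trans (map_mul _ a c))
  · obtain ⟨W, hW, a, b, hηW, e⟩ :=
      Spectrum.exists_globalSection_fraction ((j.c.app (op V)).hom c) (Spectrum.generic M) hη
    obtain ⟨a', ha⟩ := (hψ le_rfl).2 (Spectrum.sectionsRes le_top (Spectrum.globalSection a))
    obtain ⟨b', hb⟩ := (hψ le_rfl).2 (Spectrum.sectionsRes le_top (Spectrum.globalSection b))
    have hWV : hj.base_open.functor.obj W ≤ V := by
      rintro _ ⟨q, hq, rfl⟩
      exact hW hq
    have hWW : (Opens.map j.base).obj (hj.base_open.functor.obj W) ≤ W := by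
      rintro p ⟨q, hq, e⟩
      exact hj.base_open.injective e ▸ hq
    refine ⟨hj.base_open.functor.obj W, hWV, a', b', ⟨_, hηW, rfl⟩, (hψ (hWV.trans hV)).1 ?_⟩
    refine (map_mul _ _ _).trans ?_
    refine (congrArg₂ (· * ·) (hnat _ b') (hnat _ c)).trans (Eq.trans ?_ (hnat _ a').symm)
    rw [ha, hb]
    exact congrArg (Spectrum.sectionsRes hWW) e

open AlgebraicGeometry in
theorem IsAffineOpen.exists_isGenericIn {A : Opens X.carrier} {M : Type u} [CommMonoid M]
    [IsCancelMul M] (hA : IsAffineOpen X.toSheafedSpace A M) :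
    ∃ η ∈ A, IsGenericIn η A := by
  obtain ⟨i⟩ := hA
  have h1 : PresheafedSpace.IsOpenImmersion i.inv.hom :=
    inferInstanceAs (SheafedSpace.IsOpenImmersion i.inv)
  have h2 := PresheafedSpace.IsOpenImmersion.ofRestrict X.toPresheafedSpace A.isOpenEmbedding
  have hj := PresheafedSpace.IsOpenImmersion.comp (H := h1) i.inv.hom
    (hg := h2) (X.toPresheafedSpace.ofRestrict A.isOpenEmbedding)
  have hsurj : Function.Surjective i.inv.hom.base := fun y =>
    ⟨i.hom.hom.base y, congrArg (fun f => f.hom.base y) i.hom_inv_id⟩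
  have hA : Set.range (i.inv.hom ≫ X.toPresheafedSpace.ofRestrict A.isOpenEmbedding).base = A :=
    (hsurj.range_comp (Subtype.val : A → X.carrier)).trans Subtype.range_val
  exact ⟨_, (i.inv.hom.base (Spectrum.generic M)).2, isGenericIn_of_isOpenImmersion _ hA⟩

namespace IsGenericIn

variable {η : X.carrier} {A : Opens X.carrier}

/-- An equality of germs holds over a neighbourhood inside `A`, where cancellation is available.
Consequently every section of `𝒪_X` over a subset of `A` becomes a unit in `ℳ_X`. -/
theorem mem_locallyRegular (hη : IsGenericIn η A) {V : Opens X.carrier} (hV : V ≤ A) (a : X.Γ V) :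
    a ∈ X.locallyRegular V := by
  intro x hx y z h
  obtain ⟨U, hU, b, rfl⟩ := exists_germ_eq y
  obtain ⟨U', hU', c, rfl⟩ := exists_germ_eq z
  have hW : x ∈ V ⊓ (U ⊓ U') := ⟨hx, hU, hU'⟩
  have hy := X.germ_resO (inf_le_right.trans inf_le_left : V ⊓ (U ⊓ U') ≤ U) hW b
  have hz := X.germ_resO (inf_le_right.trans inf_le_right : V ⊓ (U ⊓ U') ≤ U') hW c
  rw [← X.germ_resO (inf_le_left : V ⊓ (U ⊓ U') ≤ V) hW, ← hy, ← hz] at h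
  rw [← hy, ← hz]
  rw [← map_mul, ← map_mul] at h
  obtain ⟨W, h1, h2, hxW, e⟩ := locally_eq_of_germ_eq h
  rw [map_mul, map_mul] at e
  rw [← X.germ_resO h1 hxW, hη.mul_left_cancel (h1.trans (inf_le_left.trans hV)) e,
    X.germ_resO]

/-- Near any `x` write `m = a / r` and `n = b / s` and clear denominators. The claim becomes `a s =
r b` in `𝒪_X` over a neighbourhood of `x`. This also contains `η`, so the equality may be tested
near `η`. -/
theorem eq_of_resM_eq (hη : IsGenericIn η A) {V W : Opens X.carrier} (hV : V ≤ A) (h : W ≤ V)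
    {m n : X.MeroSec V} (hW : η ∈ W) (e : X.resM h m = X.resM h n) : m = n := by
  refine sepM _ _ fun x hx => ?_
  obtain ⟨U, hU, a, r, hxU, -, ha⟩ := MonoidScheme.exists_fraction m x hx
  obtain ⟨U', hU', b, s, hxU', -, hb⟩ := MonoidScheme.exists_fraction n x hx
  have hUV : U ⊓ U' ≤ V := inf_le_left.trans hU
  have hηU : η ∈ U ⊓ U' := hη.mem (hUV.trans hV) x ⟨hxU, hxU'⟩
  refine ⟨U ⊓ U', hUV, ⟨hxU, hxU'⟩, ?_⟩
  have hr := isUnit_toMeroApp (hη.mem_locallyRegular (hUV.trans hV) (X.resO inf_le_left r))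
  have hs := isUnit_toMeroApp (hη.mem_locallyRegular (hUV.trans hV) (X.resO inf_le_right s))
  replace ha := congrArg (X.resM (inf_le_left : U ⊓ U' ≤ U)) ha
  replace hb := congrArg (X.resM (inf_le_right : U ⊓ U' ≤ U')) hb
  rw [map_mul, resM_resM, resM_toMeroApp, resM_toMeroApp] at ha hb
  refine (hr.mul hs).mul_right_cancel ?_
  rw [← mul_assoc, ha, mul_left_comm (X.resM hUV n), hb, ← map_mul, ← map_mul]
  refine congrArg _ (hη.eq_of_res_eq (hUV.trans hV) (inf_le_right : W ⊓ (U ⊓ U') ≤ U ⊓ U')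
    ⟨hW, hηU⟩ (toMeroApp_injective _ ?_))
  rw [← resM_toMeroApp, ← resM_toMeroApp, map_mul (X.toMeroApp _), map_mul (X.toMeroApp _),
    ← ha, ← hb]
  simp only [map_mul, resM_resM]
  rw [← X.resM_resM h (inf_le_left : W ⊓ (U ⊓ U') ≤ W) m, e, resM_resM, mul_assoc, mul_left_comm]

/-- Each generic point lies in the nonempty intersection `A ⊓ A'`. An open `V ≤ A` around `η` then
meets `A'`, hence contains `η'`, so `eq_of_mem` applies. -/
theorem eq_of_inter (hη : IsGenericIn η A) {η' : X.carrier} {A' : Opens X.carrier}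
    (hη' : IsGenericIn η' A') {x : X.carrier} (hx : x ∈ A) (hx' : x ∈ A') : η = η' := by
  have h : η' ∈ A := (hη'.mem (inf_le_right : A ⊓ A' ≤ A') x ⟨hx, hx'⟩).1
  have h' : η ∈ A' := (hη.mem (inf_le_left : A ⊓ A' ≤ A) x ⟨hx, hx'⟩).2
  refine (hη.eq_of_mem η' h fun V hV hηV => ?_).symm
  exact (hη'.mem (inf_le_right : V ⊓ A' ≤ A') η ⟨hηV, h'⟩).1

end IsGenericIn

end MonoidScheme

namespace MonoidScheme

variable {X : MonoidScheme.{u}}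

/-! ### Line bundles on cancellative monoid schemes -/

/-- Every point of a cancellative monoid scheme has an affine neighbourhood, with a generic point
that depends only on the component of the point. -/
theorem IsCancellative.exists_generic (hX : X.IsCancellative) :
    ∃ (A : X.carrier → Opens X.carrier) (η : X.carrier → X.carrier),
      (∀ x, x ∈ A x) ∧ (∀ x, IsGenericIn (η x) (A x)) ∧ (∀ x, ∀ y ∈ A x, η y = η x) := by
  have h : ∀ x : X.carrier, ∃ (A : Opens X.carrier) (η : X.carrier), x ∈ A ∧ IsGenericIn η A := by
    intro x
    obtain ⟨U, M, _, hx, hU⟩ := X.local_affine x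
    have := hX U M hU
    obtain ⟨η, -, h⟩ := hU.exists_isGenericIn
    exact ⟨U, η, hx, h⟩
  choose A η hA hη using h
  exact ⟨A, η, hA, hη, fun x y hy => (hη y).eq_of_inter (hη x) (hA y) hy⟩

/-- An assignment of meromorphic units to the local bases of `L`, compatible with changes of
bases, comes from an isomorphism of `L` with the line bundle of a Cartier divisor. -/
theorem exists_iso_divisorBundle (L : LineBundle X)
    (R : ∀ U : Opens X.carrier, L.Sec U → (X.MeroSec U)ˣ → Prop)
    (hR : ∀ {U e g}, R U e g → L.IsFrame e)
    (cover : ∀ x : X.carrier, ∃ (U : Opens X.carrier) (e : L.Sec U) (g : (X.MeroSec U)ˣ),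
      x ∈ U ∧ R U e g)
    (compat : ∀ {U e g U' e' g'}, R U e g → R U' e' g' →
      ∀ (W : Opens X.carrier) (h : W ≤ U) (h' : W ≤ U') (c : X.Γ W),
        L.res h' e' = c • L.res h e → X.resM h' g'.1 = X.toMeroApp W c * X.resM h g.1) :
    ∃ D : X.CartierDivisor, Nonempty (OSet.Iso L.toOSet (divisorBundle D).toOSet) := by
  -- A basis of `𝒪_X(D)` is the inverse of an equation, so the equations are the `g⁻¹`. Transition
  -- functions between bases are units of `𝒪_X` and vanish in the quotient.
  have hdiv : ∀ {U e g U' e' g'}, R U e g → R U' e' g' →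
      ∀ (W : Opens X.carrier) (h : W ≤ U) (h' : W ≤ U'),
        X.resD h (X.divOn U g⁻¹) = X.resD h' (X.divOn U' g'⁻¹) := by
    intro U e g U' e' g' H H' W h h'
    obtain ⟨a, ha⟩ := (hR H).surj h (L.res h' e')
    obtain ⟨b, hb⟩ := (hR H').surj h' (L.res h e)
    have hba : b * a = 1 := (hR H).inj h (by rw [one_smul, mul_smul, ← ha, ← hb])
    let v : (X.Γ W)ˣ := ⟨a, b, mul_comm b a ▸ hba, hba⟩
    have e : Units.map (X.resM h') g' = Units.map (X.toMeroApp W) v * Units.map (X.resM h) g :=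
      Units.ext (compat H H' W h h' a ha)
    rw [resD_divOn, resD_divOn, map_inv, map_inv, map_inv, map_inv, e, map_mul, divOn_map_toMeroApp,
      one_mul]
  choose U e g hx H using cover
  obtain ⟨D, hD, -⟩ := TopCat.Sheaf.existsUnique_gluing' X.divisorSheaf U ⊤
    (fun x => homOfLE le_top) (fun x _ => Opens.mem_iSup.2 ⟨x, hx x⟩)
    (fun x => X.divOn (U x) (g x)⁻¹) (fun x y => hdiv (H x) (H y) _ inf_le_left inf_le_right)
  replace hD : ∀ x, X.resD (le_top : U x ≤ ⊤) D = X.divOn (U x) (g x)⁻¹ := hD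
  -- `D` was glued from one chosen pair at each point; every other pair in `R` also gives an
  -- equation of it.
  have hD' : ∀ {V : Opens X.carrier} {n : L.Sec V} {f : (X.MeroSec V)ˣ}, R V n f →
      X.divOn V f⁻¹ = X.resD le_top D := fun {V n f} hf => sepD _ _ fun x hxV => by
    refine ⟨V ⊓ U x, inf_le_left, ⟨hxV, hx x⟩, ?_⟩
    rw [hdiv hf (H x) _ inf_le_left inf_le_right, ← hD, resD_resD, resD_resD]
  refine ⟨D, OSet.FrameMatch.nonempty_iso
    { R := fun V n t => ∃ f, R V n f ∧ divisorOSet.val (D := D) t = f.1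
      left := fun ⟨f, hf, _⟩ => hR hf
      right := fun ⟨f, hf, ht⟩ => divisorOSet.isFrame (hD' hf) (ht.trans (by rw [inv_inv]))
      cover := fun x => ?_
      compat := ?_ }⟩
  · obtain ⟨t, ht⟩ := divisorOSet.exists_val_eq_inv (hD' (H x))
    exact ⟨U x, e x, t, hx x, g x, H x, ht.trans (by rw [inv_inv])⟩
  · rintro V n t V' n' t' ⟨f, hf, ht⟩ ⟨f', hf', ht'⟩ W h h' c hc
    refine divisorOSet.val_injective (D := D) ?_
    refine (congrArg _ ht').trans ((compat hf hf' W h h' c hc).trans ?_)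
    rw [← ht]
    rfl

/-- The bases `ε` chosen near the generic points trivialize `L` generically. Coordinates with
respect to them turn local bases of `L` into units of `ℳ_X`. -/
theorem IsCancellative.exists_iso_divisorBundle (hX : X.IsCancellative) (L : LineBundle X) :
    ∃ D : X.CartierDivisor, Nonempty (OSet.Iso L.toOSet (divisorBundle D).toOSet) := by
  obtain ⟨A, η, hA, hη, hηA⟩ := hX.exists_generic
  choose B ε hB hε using L.locally_trivial
  refine MonoidScheme.exists_iso_divisorBundle L
    -- `g` is the meromorphic function that near each generic point `η x` is the coordinate of `e`
    -- in `ε (η x)`. The condition ranges over all `x ∈ U`, as `U` may meet several components.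
    (fun U e g => L.IsFrame e ∧ ∀ x ∈ U, ∃ (W : Opens X.carrier) (h : W ≤ U) (hW : W ≤ B (η x))
      (c : X.Γ W), η x ∈ W ∧ L.res h e = c • L.res hW (ε (η x)) ∧
        X.resM h g.1 = X.toMeroApp W c) (fun h => h.1) (fun x => ?_) ?_
  · obtain ⟨U, e, hxU, he⟩ := L.locally_trivial x
    have hηV : η x ∈ U ⊓ A x := (hη x).mem inf_le_right x ⟨hxU, hA x⟩
    obtain ⟨c, hc⟩ := (hε (η x)).surj (inf_le_right : U ⊓ A x ⊓ B (η x) ≤ B (η x))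
      (L.res (inf_le_left.trans inf_le_left) e)
    obtain ⟨W, hW, a, b, hηW, hab⟩ := (hη x).exists_fraction
      (inf_le_left.trans inf_le_right : U ⊓ A x ⊓ B (η x) ≤ A x) c ⟨hηV, hB _⟩
    obtain ⟨α, hα⟩ := isUnit_toMeroApp ((hη x).mem_locallyRegular le_rfl a)
    obtain ⟨β, hβ⟩ := isUnit_toMeroApp ((hη x).mem_locallyRegular le_rfl b)
    -- The unit is the fraction `a / b`, which equals the coordinate `c` near `η x`. All points of
    -- `A x` share the generic point, so one neighbourhood `W` serves them all.
    refine ⟨U ⊓ A x, L.res inf_le_left e, Units.map (X.resM inf_le_right) (β⁻¹ * α),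
      ⟨hxU, hA x⟩, he.res _, fun y hy => ?_⟩
    rw [hηA x y hy.2]
    refine ⟨W, hW.trans inf_le_left, hW.trans inf_le_right, X.resO hW c, hηW, ?_, ?_⟩
    · have := congrArg (L.res hW) hc
      rw [L.res_res, L.res_smul, L.res_res] at this
      rw [L.res_res]
      exact this
    · have hWA : W ≤ A x := (hW.trans inf_le_left).trans inf_le_right
      have key := congrArg (X.toMeroApp W) hab
      rw [map_mul, ← resM_toMeroApp hWA, ← resM_toMeroApp hWA, ← hα, ← hβ] at key
      refine (Units.mul_right_inj (Units.map (X.resM hWA) β)).1 (Eq.trans ?_ key.symm)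
      refine (congrArg _ (resM_resM _ _ _)).trans ?_
      refine (map_mul (X.resM hWA) _ _).symm.trans (congrArg _ ?_)
      exact β.mul_inv_cancel_left α.1
  · rintro U e g U' e' g' ⟨he, H⟩ ⟨he', H'⟩ W h h' c hc
    refine sepM _ _ fun x hx => ⟨W ⊓ A x, inf_le_left, ⟨hx, hA x⟩, ?_⟩
    obtain ⟨V, hV, hVB, d, hηV, hd, hd'⟩ := H x (h hx)
    obtain ⟨V', hV', hVB', d', hηV', hs, hs'⟩ := H' x (h' hx)
    have hηW : η x ∈ W ⊓ A x := (hη x).mem inf_le_right x ⟨hx, hA x⟩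
    have hTV : W ⊓ A x ⊓ (V ⊓ V') ≤ V := inf_le_right.trans inf_le_left
    have hTV' : W ⊓ A x ⊓ (V ⊓ V') ≤ V' := inf_le_right.trans inf_le_right
    have hTW : W ⊓ A x ⊓ (V ⊓ V') ≤ W := inf_le_left.trans inf_le_left
    -- It suffices to compare near `η x`. There `e = d ε` and `e' = d' ε`, so `e' = c e` gives `d' =
    -- c d`, while `g` and `g'` equal `d` and `d'`.
    refine (hη x).eq_of_resM_eq inf_le_right (inf_le_left : W ⊓ A x ⊓ (V ⊓ V') ≤ W ⊓ A x)
      ⟨hηW, hηV, hηV'⟩ ?_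
    have e1 := congrArg (L.res hTV) hd
    have e2 := congrArg (L.res hTV') hs
    have e3 := congrArg (L.res hTW) hc
    have f1 := congrArg (X.resM hTV) hd'
    have f2 := congrArg (X.resM hTV') hs'
    rw [L.res_smul, L.res_res, L.res_res] at e1 e2 e3
    rw [resM_resM, resM_toMeroApp] at f1 f2
    have key : X.resO hTV' d' = X.resO hTW c * X.resO hTV d :=
      (hε (η x)).inj (hTV.trans hVB) (by rw [mul_smul, ← e1, ← e3, e2])
    simp only [map_mul, resM_resM, resM_toMeroApp, resO_resO]
    rw [f2, f1, key, map_mul]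

end MonoidScheme

/-! ### The induced homomorphism `CaCl(X) → Pic(X)` -/

theorem mainTheorem7 (X : MonoidScheme.{u}) :
    ∃ φ : X.CaCl →* X.Pic,
      (∀ D : X.CartierDivisor, ∃ L : MonoidScheme.LineBundle X,
        MonoidScheme.IsSheafOfDivisor D L ∧
          φ (QuotientGroup.mk' X.principalDivisors D) = MonoidScheme.Pic.mk L) ∧
      Function.Injective φ ∧
      (X.IsCancellative → Function.Bijective φ) := by
  have hker := MonoidScheme.ker_divisorClassHom X
  have hinj : Function.Injective
      (QuotientGroup.lift X.principalDivisors (MonoidScheme.divisorClassHom X) hker.ge) :=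
    (QuotientGroup.injective_lift_iff _ _ hker.ge).2 hker.symm
  refine ⟨QuotientGroup.lift X.principalDivisors (MonoidScheme.divisorClassHom X) hker.ge,
    fun D => ⟨_, MonoidScheme.isSheafOfDivisor_divisorBundle D, rfl⟩, hinj,
    fun hX => ⟨hinj, ?_⟩⟩
  rintro ⟨L⟩
  obtain ⟨D, hD⟩ := hX.exists_iso_divisorBundle L
  exact ⟨QuotientGroup.mk' _ D, (Quotient.sound hD).symm⟩
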